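/- Let $\Gamma$ be a totally ordered abelian group and $F$ a field with a valuation $\nu:F^\times\to\Gamma$ split by a homomorphism $t:\Gamma\to F^\times$ ($\nu\circ t=\mathrm{id}_\Gamma$), with ring of integers $\mathcal O$ and residue map $x\mapsto\overline x$ onto the residue field $\kappa$, which is a local field (a non-discrete locally compact field, archimedean or not). Fix a Haar measure on $\kappa$ and the product measures on $\kappa^n$; let $|\cdot|_\kappa$ be the normalised absolute value of $\kappa$ (the factor by which multiplication scales Haar measure). Let $\mathbb C(\Gamma)$ be the fraction field of the complex group algebra of $\Gamma$, with basis elements $X^\gamma$. For $\alpha\in F^\times$ put $|\alpha|=\bigl|\overline{\alpha\,t(-\nu(\alpha))}\bigr|_\kappa X^{\nu(\alpha)}\in\mathbb C(\Gamma)$. For $g:\kappa^n\to\mathbb C$, $a\in F^n$, $\gamma\in\Gamma^n$, the lift $g^{a,\gamma}:F^n\to\mathbb C$ is defined by $g^{a,\gamma}(x)=g\bigl(\overline{(x_1-a_1)t(-\gamma_1)},\dots,\overline{(x_n-a_n)t(-\gamma_n)}\bigr)$ if all $(x_i-a_i)t(-\gamma_i)\in\mathcal O$, and $0$ otherwise.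 Let $\mathcal L(F)$ be the $\mathbb C(\Gamma)$-span of the functions $g^{a,\gamma}X^{\delta}$ with $g:\kappa\to\mathbb C$ Haar integrable, $a\in F$, $\gamma,\delta\in\Gamma$; the integral $\int^F$ on $\mathcal L(F)$ is the $\mathbb C(\Gamma)$-linear functional with $\int^F g^{a,\gamma}=X^{\gamma}\int_\kappa g$. A function $f:F^n\to\mathbb C(\Gamma)$ is Fubini if, recursively: for $n=1$, $f\in\mathcal L(F)$; for $n>1$, for each $r$ all sections of $f$ in the variable $x_r$ lie in $\mathcal L(F)$, the function obtained by integrating out $x_r$ is Fubini on $F^{n-1}$, and its repeated integral does not depend on $r$. The common value is the repeated integral $\int^{F^n}f$. A function $g:\kappa^n\to\mathbb C$ is Fubini if it is Haar integrable and satisfies the analogous recursive condition for the Haar integral (every section and partial integral being defined everywhere), and GL-Fubini if $g\circ\tau$ is Fubini for all $\tau\in GL_n(\kappa)$. Let $\mathcal L(F^n,GL_n)$ be the $\mathbb C(\Gamma)$-span of the functions $g^{a,\gamma}\circ\tau$ with $g$ GL-Fubini on $\kappa^n$, $a\in F^n$, $\gamma\in\Gamma^n$, $\tau\in GL_n(F)$.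 Fix an $F$-linear isomorphism $T:F^{N^2}\to M_N(F)$. Let $\mathcal L(M_N(F))$ be the space of $f:M_N(F)\to\mathbb C(\Gamma)$ with $f\circ T\in\mathcal L(F^{N^2},GL_{N^2})$, and $\int^{M_N(F)}f=\int^{F^{N^2}}f\circ T$. Let $\mathcal L(GL_N(F))$ be the space of $\phi:GL_N(F)\to\mathbb C(\Gamma)$ such that $\tau\mapsto\phi(\tau)|\det\tau|^{-N}$ extends to a function $f\in\mathcal L(M_N(F))$, and put $\int^{GL_N(F)}\phi=\int^{M_N(F)}f$. **Proposition.** Let $\phi\in\mathcal L(GL_N(F))$ and $\sigma\in GL_N(F)$. The integral of $\phi$ is well defined: for every extension $f\in\mathcal L(M_N(F))$ of $\tau\mapsto\phi(\tau)|\det\tau|^{-N}$ the function $f\circ T$ is Fubini and $\int^{M_N(F)}f=\int^{GL_N(F)}\phi$. The functions $\tau\mapsto\phi(\sigma\tau)$ and $\tau\mapsto\phi(\tau\sigma)$ belong to $\mathcal L(GL_N(F))$, and $$\int^{GL_N(F)}\phi(\sigma\tau)\,d\tau=\int^{GL_N(F)}\phi(\tau)\,d\tau=\int^{GL_N(F)}\phi(\tau\sigma)\,d\tau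 .$$ -/

import Mathlib

open MeasureTheory
open scoped Matrix MatrixGroups

noncomputable section

namespace ValuedIntegration

/-- A field `F` with a split valuation `ν : Fˣ → Γ` (with `ν 0 = ⊤`), a splitting `t : Γ → Fˣ`,
and a residue map `ρ` from the ring of integers onto the residue field `κ`.
The kernel of `ρ` is automatically the maximal ideal, as `κ` is a field. -/
structure SplitValuation (F Γ κ : Type*) [Field F] [AddCommGroup Γ] [LinearOrder Γ]
    [IsOrderedAddMonoid Γ] [Field κ] where
  /-- the valuation, written additively -/
  ν : AddValuation F (WithTop Γ)
  /-- the splitting -/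
  t : Multiplicative Γ →* Fˣ
  ν_t : ∀ γ : Γ, ν (t (Multiplicative.ofAdd γ) : F) = (γ : WithTop Γ)
  /-- the residue map; the integers of `ν.toValuation` are the `x` with `0 ≤ ν x` -/
  ρ : ν.toValuation.integer →+* κ
  ρ_surjective : Function.Surjective ρ

/-- `ℂ(Γ)`, the field of fractions of the complex group algebra of `Γ`. -/
abbrev CField (Γ : Type*) [AddCommGroup Γ] [LinearOrder Γ] [IsOrderedAddMonoid Γ] : Type _ :=
  FractionRing (AddMonoidAlgebra ℂ Γ)

/-- The element `X^γ` of `ℂ(Γ)`. -/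
def X {Γ : Type*} [AddCommGroup Γ] [LinearOrder Γ] [IsOrderedAddMonoid Γ] (γ : Γ) : CField Γ :=
  algebraMap (AddMonoidAlgebra ℂ Γ) (CField Γ) (AddMonoidAlgebra.single γ 1)

/-- Iterated integration in every order. Given a set `L` of "integrable" functions on `A` and
an "integral" `I` on them, `HasRepeatedIntegral L I n f c` says that all sections of `f` in one
variable are integrable, that integrating out any one variable leaves a function on `A ^ (n-1)`
with the same property, and that the value of the repeated integral is always `c`.
The recursion starts from the one-point space `A ^ 0`, so that for `n = 1` the condition says
exactly that `f` is integrable with integral `c`. -/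
def HasRepeatedIntegral {A C : Type*} (L : Set (A → C)) (I : (A → C) → C) :
    (n : ℕ) → ((Fin n → A) → C) → C → Prop
  | 0, f, c => f Fin.elim0 = c
  | n + 1, f, c => ∀ r : Fin (n + 1),
      (∀ y : Fin n → A, (fun x : A => f (Fin.insertNth (α := fun _ => A) r x y)) ∈ L) ∧
      HasRepeatedIntegral L I n
        (fun y => I (fun x : A => f (Fin.insertNth (α := fun _ => A) r x y))) c

section Residue

variable {κ : Type*} [NontriviallyNormedField κ] [MeasurableSpace κ]

/-- A complex function on `κ ^ n` is Fubini if it is Haar integrable for the product measure and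
all its repeated integrals are everywhere defined (and equal). -/
def IsFubiniResidue (μ : Measure κ) (n : ℕ) (g : (Fin n → κ) → ℂ) : Prop :=
  Integrable g (Measure.pi fun _ => μ) ∧
    ∃ c : ℂ, HasRepeatedIntegral {h : κ → ℂ | Integrable h μ} (fun h => ∫ u, h u ∂μ) n g c

/-- `g` is GL-Fubini if `g ∘ τ` is Fubini for every `τ ∈ GL_n(κ)`. -/
def IsGLFubini (μ : Measure κ) (n : ℕ) (g : (Fin n → κ) → ℂ) : Prop :=
  ∀ τ : GL (Fin n) κ, IsFubiniResidue μ n (fun u => g ((τ : Matrix (Fin n) (Fin n) κ) *ᵥ u))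

/-- The normalised absolute value of the local field `κ`: multiplication by `u` scales Haar
measure by `residueAbs u`. -/
def residueAbs {κ : Type*} [NontriviallyNormedField κ] [LocallyCompactSpace κ] (u : κ) : ℝ :=
  open Classical in
  if h : u ≠ 0 then (distribHaarChar κ (Units.mk0 u h) : ℝ) else 0

end Residue

namespace SplitValuation

variable {F Γ κ : Type*} [Field F] [AddCommGroup Γ] [LinearOrder Γ] [IsOrderedAddMonoid Γ]

section Algebra

variable [Field κ] (D : SplitValuation F Γ κ)

/-- The element `t(γ)` of `F`. -/
def tt (γ : Γ) : F := (D.t (Multiplicative.ofAdd γ) : F)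

/-- The residue class of `x`, extended by zero off the ring of integers. -/
def residue (x : F) : κ :=
  open Classical in
  if h : x ∈ D.ν.toValuation.integer then D.ρ ⟨x, h⟩ else 0

/-- The value `ν(α) ∈ Γ` of a non-zero element. -/
def val (α : Fˣ) : Γ :=
  (D.ν (α : F)).untop ((AddValuation.ne_top_iff D.ν).2 α.ne_zero)

/-- The lift `g^{a,γ}` of `g : κ → ℂ` to `F`, as a `ℂ(Γ)`-valued function:
`g` of the residue class of `(x - a) t(-γ)` if this element is integral, and `0` otherwise. -/
def lift (g : κ → ℂ) (a : F) (γ : Γ) (x : F) : CField Γ :=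
  open Classical in
  if 0 ≤ D.ν ((x - a) * D.tt (-γ)) then
    algebraMap ℂ (CField Γ) (g (D.residue ((x - a) * D.tt (-γ))))
  else 0

/-- The lift `g^{a,γ}` of `g : κ ^ n → ℂ` to `F ^ n`. -/
def liftPi {n : ℕ} (g : (Fin n → κ) → ℂ) (a : Fin n → F) (γ : Fin n → Γ) (x : Fin n → F) :
    CField Γ :=
  open Classical in
  if ∀ i, 0 ≤ D.ν ((x i - a i) * D.tt (-γ i)) then
    algebraMap ℂ (CField Γ) (g fun i => D.residue ((x i - a i) * D.tt (-γ i)))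
  else 0

end Algebra

variable [NontriviallyNormedField κ] (D : SplitValuation F Γ κ)

/-- The absolute value `|α| = |residue of α t(-ν(α))| X^{ν(α)} ∈ ℂ(Γ)` of `α ∈ Fˣ`. -/
def absVal [LocallyCompactSpace κ] (α : Fˣ) : CField Γ :=
  algebraMap ℂ (CField Γ) (residueAbs (D.residue ((α : F) * D.tt (-D.val α))) : ℂ) * X (D.val α)

variable [MeasurableSpace κ] (μ : Measure κ)

/-- `𝓛(F)`: the `ℂ(Γ)`-space spanned by the simple functions `g^{a,γ} X^δ`. -/
def integrableFun : Submodule (CField Γ) (F → CField Γ) :=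
  Submodule.span (CField Γ)
    {f | ∃ (g : κ → ℂ) (a : F) (γ δ : Γ), Integrable g μ ∧ f = fun x => D.lift g a γ x * X δ}

/-- The graph of the integral on `F`: the span of the pairs
`(g^{a,γ} X^δ, (∫ g) X^γ X^δ)`. -/
def integralGraph : Submodule (CField Γ) ((F → CField Γ) × CField Γ) :=
  Submodule.span (CField Γ)
    {p | ∃ (g : κ → ℂ) (a : F) (γ δ : Γ), Integrable g μ ∧
      p = (fun x => D.lift g a γ x * X δ,
        algebraMap ℂ (CField Γ) (∫ u, g u ∂μ) * X γ * X δ)}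

open Classical in
/-- The integral on `F`: the `ℂ(Γ)`-linear functional on `𝓛(F)` sending `g^{a,γ}` to
`(∫ g) X^γ` (and `0` outside `𝓛(F)`). -/
def integral (f : F → CField Γ) : CField Γ :=
  if h : ∃ c, (f, c) ∈ D.integralGraph μ then h.choose else 0

/-- `c` is the repeated integral, in every order, of `f` on `F ^ n`. -/
def HasIntegralPi {n : ℕ} (f : (Fin n → F) → CField Γ) (c : CField Γ) : Prop :=
  HasRepeatedIntegral (D.integrableFun μ : Set (F → CField Γ)) (D.integral μ) n f c

/-- `f` is Fubini on `F ^ n`. -/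
def IsFubini {n : ℕ} (f : (Fin n → F) → CField Γ) : Prop :=
  ∃ c, D.HasIntegralPi μ f c

open Classical in
/-- The repeated integral of a Fubini function on `F ^ n` (and `0` for other functions). -/
def integralPi {n : ℕ} (f : (Fin n → F) → CField Γ) : CField Γ :=
  if h : D.IsFubini μ f then h.choose else 0

/-- `𝓛(F ^ n, GL_n)`: the `ℂ(Γ)`-space spanned by the functions `g^{a,γ} ∘ τ` with `g`
GL-Fubini and `τ ∈ GL_n(F)`. -/
def integrablePi (n : ℕ) : Submodule (CField Γ) ((Fin n → F) → CField Γ) :=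
  Submodule.span (CField Γ)
    {f | ∃ (g : (Fin n → κ) → ℂ) (a : Fin n → F) (γ : Fin n → Γ) (τ : GL (Fin n) F),
      IsGLFubini μ n g ∧
        f = fun x => D.liftPi g a γ ((τ : Matrix (Fin n) (Fin n) F) *ᵥ x)}

variable {N : ℕ} (T : (Fin (N ^ 2) → F) ≃ₗ[F] Matrix (Fin N) (Fin N) F)

/-- `𝓛(M_N(F))`: the functions `f` on matrices with `f ∘ T ∈ 𝓛(F ^ (N²), GL)`. -/
def integrableMat : Submodule (CField Γ) (Matrix (Fin N) (Fin N) F → CField Γ) :=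
  (D.integrablePi μ (N ^ 2)).comap (LinearMap.funLeft (CField Γ) (CField Γ) T)

/-- The integral on `M_N(F)`, through the identification `T`. -/
def integralMat (f : Matrix (Fin N) (Fin N) F → CField Γ) : CField Γ :=
  D.integralPi μ (f ∘ T)

/-- `f ∈ 𝓛(M_N(F))` extends the function `τ ↦ φ(τ) |det τ|^{-N}` on `GL_N(F)`. -/
def IsExtension [LocallyCompactSpace κ] (φ : GL (Fin N) F → CField Γ)
    (f : Matrix (Fin N) (Fin N) F → CField Γ) : Prop :=
  f ∈ D.integrableMat μ T ∧
    ∀ τ : GL (Fin N) F,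
      f (τ : Matrix (Fin N) (Fin N) F) =
        φ τ * (D.absVal (Matrix.GeneralLinearGroup.det τ) ^ N)⁻¹

/-- `𝓛(GL_N(F))`: the functions `φ` for which `τ ↦ φ(τ) |det τ|^{-N}` extends to a function of
`𝓛(M_N(F))`. -/
def integrableGL [LocallyCompactSpace κ] : Set (GL (Fin N) F → CField Γ) :=
  {φ | ∃ f, D.IsExtension μ T φ f}

open Classical in
/-- The integral on `GL_N(F)`: the integral over `M_N(F)` of an extension of
`τ ↦ φ(τ) |det τ|^{-N}` (and `0` outside `𝓛(GL_N(F))`). -/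
def integralGL [LocallyCompactSpace κ] (φ : GL (Fin N) F → CField Γ) : CField Γ :=
  if h : ∃ f, D.IsExtension μ T φ f then D.integralMat μ T h.choose else 0

end SplitValuation

end ValuedIntegration

end

/-! Left and right multiplication by `σ` on `M_N(F)` both have determinant `(det σ)^N`. Invariance
is therefore the linear change of variables formula, whose Jacobian `|det σ|^{-N}` is compensated by
the weight `|det τ|^{-N}`. Three facts carry the argument.

The integral on `F` exists (`sum_integral_eq_zero`). Given a linear relation between lifts, restrict
it to a ball of least radius among their supports. Every lift not carried by that ball is constant
on it, so on `κ` a combination of translated integrable functions is constant. As `κ` has infinite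
Haar measure, the constant is zero. The terms carried by the ball thus satisfy a relation of their
own, their integrals cancel, and the remaining terms are treated by induction.

Lifts composed with affine maps are Fubini, with the expected Jacobian (`hasIntegralPi_liftInt`). To
integrate out `x_r`, the entry of least valuation in column `r` serves as pivot. Clearing the column
is then a shear with integral entries, which acts on lifts through its reduction, a shear of `κ^n`;
this is where the GL-Fubini condition enters. The pivot contributes `|d|^{-1}` and the cofactor the
rest of `|det|^{-1}`, so the value does not depend on the order of integration.

Two extensions of the same function differ only on the zeros of the determinant, and a Fubini
function supported on the zeros of a non-zero polynomial has integral zero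
(`HasIntegralPi.eq_zero_of_support`). -/

noncomputable section

namespace ValuedIntegration

/-! ### Monomials in `ℂ(Γ)` -/

section GroupAlgebra

variable {Γ : Type*} [AddCommGroup Γ] [LinearOrder Γ] [IsOrderedAddMonoid Γ]

theorem X_add (γ δ : Γ) : X (γ + δ) = X γ * X δ := by
  simp [X, ← map_mul, AddMonoidAlgebra.single_mul_single]

theorem X_zero : X (0 : Γ) = 1 := by
  rw [X, ← AddMonoidAlgebra.one_def, map_one]

theorem X_neg_mul (γ : Γ) : X (-γ) * X γ = 1 := by
  rw [← X_add, neg_add_cancel, X_zero]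

theorem X_ne_zero (γ : Γ) : X γ ≠ 0 := right_ne_zero_of_mul_eq_one (X_neg_mul γ)

theorem X_neg (γ : Γ) : X (-γ) = (X γ)⁻¹ := eq_inv_of_mul_eq_one_left (X_neg_mul γ)

theorem X_sum {ι : Type*} (s : Finset ι) (γ : ι → Γ) :
    X (∑ i ∈ s, γ i) = ∏ i ∈ s, X (γ i) := by
  classical
  induction s using Finset.induction_on with
  | empty => simp [X_zero]
  | insert i s hi ih => rw [Finset.sum_insert hi, Finset.prod_insert hi, X_add, ih]

end GroupAlgebra

/-! ### Scaling of Haar measure on `κ` -/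

section ResidueAbs

variable {κ : Type*} [NontriviallyNormedField κ] [LocallyCompactSpace κ]

theorem residueAbs_unit (u : κˣ) : residueAbs (u : κ) = (distribHaarChar κ u : ℝ) := by
  simp [residueAbs]

theorem residueAbs_pos {u : κ} (hu : u ≠ 0) : 0 < residueAbs u := by
  rw [residueAbs, dif_pos hu]
  exact NNReal.coe_pos.2 distribHaarChar_pos

theorem residueAbs_mul (u v : κ) : residueAbs (u * v) = residueAbs u * residueAbs v := by
  by_cases hu : u = 0
  · simp [residueAbs, hu]
  by_cases hv : v = 0
  · simp [residueAbs, hv]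
  lift u to κˣ using IsUnit.mk0 u hu
  lift v to κˣ using IsUnit.mk0 v hv
  rw [← Units.val_mul, residueAbs_unit, residueAbs_unit, residueAbs_unit, map_mul, NNReal.coe_mul]

theorem residueAbs_one : residueAbs (1 : κ) = 1 := by
  have := residueAbs_unit (1 : κˣ)
  simpa using this

/-- A positive real with square one. This disposes of the sign in the cofactor expansion. -/
theorem residueAbs_neg_one : residueAbs (-1 : κ) = 1 := by
  have h := residueAbs_mul (-1 : κ) (-1)
  rw [neg_one_mul, neg_neg, residueAbs_one] at h
  have := residueAbs_pos (neg_ne_zero.2 one_ne_zero : (-1 : κ) ≠ 0)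
  nlinarith

variable [MeasurableSpace κ] [BorelSpace κ] (μ : Measure κ) [μ.IsAddHaarMeasure]

open scoped Pointwise in
theorem map_mul_left_eq_smul {u : κ} (hu : u ≠ 0) :
    μ.map (fun x => u * x) = ENNReal.ofReal (residueAbs u)⁻¹ • μ := by
  have : ProperSpace κ := ProperSpace.of_locallyCompactSpace κ
  lift u to κˣ using IsUnit.mk0 u hu
  ext s hs
  rw [Measure.map_apply (by fun_prop) hs]
  have h1 : (fun x => (u : κ) * x) ⁻¹' s = (u⁻¹ • s : Set κ) := by
    ext x
    rw [Set.mem_inv_smul_set_iff]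
    rfl
  rw [h1, ← distribHaarChar_mul, residueAbs_unit, map_inv, ← NNReal.coe_inv,
    ENNReal.ofReal_coe_nnreal]
  rfl

theorem integrable_comp_mul_left {u : κ} (hu : u ≠ 0) {g : κ → ℂ} (hg : Integrable g μ) :
    Integrable (fun x => g (u * x)) μ := by
  have e : MeasurableEmbedding (fun x : κ => u * x) := (Homeomorph.mulLeft₀ u hu).measurableEmbedding
  refine (e.integrable_map_iff (μ := μ) (g := g)).1 ?_
  rw [map_mul_left_eq_smul μ hu]
  exact hg.smul_measure (by simp)

theorem integral_comp_mul_left {u : κ} (hu : u ≠ 0) (g : κ → ℂ) :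
    ∫ x, g (u * x) ∂μ = ((residueAbs u)⁻¹ : ℝ) * ∫ x, g x ∂μ := by
  have e : MeasurableEmbedding (fun x : κ => u * x) := (Homeomorph.mulLeft₀ u hu).measurableEmbedding
  rw [← e.integral_map (μ := μ) g, map_mul_left_eq_smul μ hu, integral_smul_measure,
    ENNReal.toReal_ofReal (inv_nonneg.2 (residueAbs_pos hu).le), Complex.real_smul]

end ResidueAbs

namespace SplitValuation

variable {F Γ κ : Type*} [Field F] [AddCommGroup Γ] [LinearOrder Γ] [IsOrderedAddMonoid Γ]

/-! ### The residue map and the splitting -/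

section Residue

variable [Field κ] (D : SplitValuation F Γ κ)

theorem residue_eq {x : F} (hx : 0 ≤ D.ν x) : D.residue x = D.ρ ⟨x, hx⟩ := dif_pos hx

theorem nonneg_add {x y : F} (hx : 0 ≤ D.ν x) (hy : 0 ≤ D.ν y) : 0 ≤ D.ν (x + y) :=
  D.ν.map_le_add hx hy

theorem nonneg_sub {x y : F} (hx : 0 ≤ D.ν x) (hy : 0 ≤ D.ν y) : 0 ≤ D.ν (x - y) :=
  D.ν.map_le_sub hx hy

theorem nonneg_mul {x y : F} (hx : 0 ≤ D.ν x) (hy : 0 ≤ D.ν y) : 0 ≤ D.ν (x * y) := by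
  rw [D.ν.map_mul]
  exact add_nonneg hx hy

theorem residue_add {x y : F} (hx : 0 ≤ D.ν x) (hy : 0 ≤ D.ν y) :
    D.residue (x + y) = D.residue x + D.residue y := by
  rw [D.residue_eq hx, D.residue_eq hy, D.residue_eq (D.nonneg_add hx hy), ← map_add]
  rfl

theorem residue_sub {x y : F} (hx : 0 ≤ D.ν x) (hy : 0 ≤ D.ν y) :
    D.residue (x - y) = D.residue x - D.residue y := by
  rw [D.residue_eq hx, D.residue_eq hy, D.residue_eq (D.nonneg_sub hx hy), ← map_sub]
  rfl

theorem residue_mul {x y : F} (hx : 0 ≤ D.ν x) (hy : 0 ≤ D.ν y) :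
    D.residue (x * y) = D.residue x * D.residue y := by
  rw [D.residue_eq hx, D.residue_eq hy, D.residue_eq (D.nonneg_mul hx hy), ← map_mul]
  rfl

theorem residue_one : D.residue 1 = 1 := by
  rw [D.residue_eq (by simp)]
  exact map_one D.ρ

theorem residue_zero : D.residue 0 = 0 := by
  rw [D.residue_eq (by simp)]
  exact map_zero D.ρ

theorem exists_residue_eq (u : κ) : ∃ x, 0 ≤ D.ν x ∧ D.residue x = u := by
  obtain ⟨⟨x, hx⟩, rfl⟩ := D.ρ_surjective u
  exact ⟨x, hx, D.residue_eq hx⟩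

theorem residue_ne_zero {x : F} (hx : D.ν x = 0) : D.residue x ≠ 0 := by
  have h0 : x ≠ 0 := by
    rintro rfl
    simp at hx
  have hinv : D.ν x⁻¹ = 0 := by
    rw [D.ν.map_inv, hx, neg_zero]
  intro h
  have := D.residue_mul hx.ge hinv.ge
  rw [mul_inv_cancel₀ h0, D.residue_one, h, zero_mul] at this
  exact one_ne_zero this

/-- Otherwise lift the inverse of the residue to an integral `y`: then `1 - x * y` has value zero,
hence non-zero residue, while its residue is `1 - 1`. -/
theorem residue_eq_zero {x : F} (hx : 0 < D.ν x) : D.residue x = 0 := by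
  by_contra h
  obtain ⟨y, hy, hxy⟩ := D.exists_residue_eq (D.residue x)⁻¹
  have hpos : 0 < D.ν (x * y) := by
    rw [D.ν.map_mul]
    exact add_pos_of_pos_of_nonneg hx hy
  have hone : D.ν (1 - x * y) = 0 := by
    rw [D.ν.map_sub_eq_of_lt_left (by simpa using hpos), D.ν.map_one]
  refine D.residue_ne_zero hone ?_
  rw [D.residue_sub (by simp) hpos.le, D.residue_one, D.residue_mul hx.le hy, hxy,
    mul_inv_cancel₀ h, sub_self]

theorem ν_tt (γ : Γ) : D.ν (D.tt γ) = γ := D.ν_t γ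

theorem tt_add (γ δ : Γ) : D.tt (γ + δ) = D.tt γ * D.tt δ := by
  simp [tt, ofAdd_add]

theorem tt_zero : D.tt 0 = 1 := by simp [tt]

theorem tt_mul_tt_neg (γ : Γ) : D.tt γ * D.tt (-γ) = 1 := by
  rw [← tt_add, add_neg_cancel, tt_zero]

theorem ν_mul_tt_neg (x : F) (γ : Γ) : D.ν (x * D.tt (-γ)) = D.ν x + ((-γ : Γ) : WithTop Γ) := by
  rw [D.ν.map_mul, ν_tt]

theorem nonneg_mul_tt_neg (x : F) (γ : Γ) : 0 ≤ D.ν (x * D.tt (-γ)) ↔ (γ : WithTop Γ) ≤ D.ν x := by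
  rw [ν_mul_tt_neg]
  induction D.ν x using WithTop.recTopCoe with
  | top => simp
  | coe a =>
    norm_cast
    rw [← sub_eq_add_neg, sub_nonneg]

theorem pos_mul_tt_neg (x : F) (γ : Γ) : 0 < D.ν (x * D.tt (-γ)) ↔ (γ : WithTop Γ) < D.ν x := by
  rw [ν_mul_tt_neg]
  induction D.ν x using WithTop.recTopCoe with
  | top => simp
  | coe a =>
    norm_cast
    rw [← sub_eq_add_neg, sub_pos]

theorem coe_val (α : Fˣ) : (D.val α : WithTop Γ) = D.ν (α : F) := WithTop.coe_untop _ _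

theorem val_eq_iff (α : Fˣ) (γ : Γ) : D.val α = γ ↔ D.ν (α : F) = γ := by
  rw [← coe_val, WithTop.coe_inj]

theorem val_mul (α β : Fˣ) : D.val (α * β) = D.val α + D.val β := by
  rw [val_eq_iff, Units.val_mul, D.ν.map_mul, ← coe_val, ← coe_val, WithTop.coe_add]

theorem ν_angular (α : Fˣ) : D.ν ((α : F) * D.tt (-D.val α)) = 0 := by
  rw [ν_mul_tt_neg, ← coe_val]
  norm_cast
  exact add_neg_cancel _

end Residue

/-! ### Multiplicativity of the `ℂ(Γ)`-valued absolute value -/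

section AbsVal

variable [NontriviallyNormedField κ] [LocallyCompactSpace κ] (D : SplitValuation F Γ κ)

theorem absVal_mul (α β : Fˣ) : D.absVal (α * β) = D.absVal α * D.absVal β := by
  have h : ((α * β : Fˣ) : F) * D.tt (-D.val (α * β)) =
      ((α : F) * D.tt (-D.val α)) * ((β : F) * D.tt (-D.val β)) := by
    rw [val_mul, neg_add, tt_add, Units.val_mul]
    ring
  simp only [absVal]
  rw [h, D.residue_mul (D.ν_angular α).ge (D.ν_angular β).ge, residueAbs_mul, Complex.ofReal_mul,
    map_mul, val_mul, X_add]
  ring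

theorem absVal_ne_zero (α : Fˣ) : D.absVal α ≠ 0 := by
  refine mul_ne_zero ?_ (X_ne_zero _)
  rw [Ne, map_eq_zero_iff _ (FaithfulSMul.algebraMap_injective _ _)]
  exact_mod_cast (residueAbs_pos (D.residue_ne_zero (D.ν_angular α))).ne'

theorem absVal_of_val_zero {α : Fˣ} (h : D.ν (α : F) = 0) :
    D.absVal α = algebraMap ℂ (CField Γ) (residueAbs (D.residue (α : F)) : ℂ) := by
  have h0 : D.val α = 0 := by rw [val_eq_iff, h, WithTop.coe_zero]
  rw [absVal, h0, neg_zero, tt_zero, mul_one, X_zero, mul_one]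

theorem absVal_one : D.absVal 1 = 1 := by
  rw [absVal_of_val_zero _ (by simp), Units.val_one, residue_one, residueAbs_one]
  simp

theorem absVal_neg_one : D.absVal (-1) = 1 := by
  rw [absVal_of_val_zero _ (by simp)]
  have : D.residue ((-1 : Fˣ) : F) = -1 := by
    have := D.residue_sub (x := 0) (y := 1) (by simp) (by simp)
    rw [residue_one, residue_zero, zero_sub, zero_sub] at this
    simpa using this
  rw [this, residueAbs_neg_one]
  simp

/-- The absolute value as a group homomorphism. -/
def absHom : Fˣ →* CField Γ where
  toFun := D.absVal
  map_one' := D.absVal_one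
  map_mul' := D.absVal_mul

theorem absVal_pow (α : Fˣ) (n : ℕ) : D.absVal (α ^ n) = D.absVal α ^ n := map_pow D.absHom α n

theorem absVal_neg_one_pow (n : ℕ) : D.absVal ((-1) ^ n) = 1 := by
  rw [absVal_pow, absVal_neg_one, one_pow]

theorem absVal_prod {ι : Type*} (s : Finset ι) (α : ι → Fˣ) :
    D.absVal (∏ i ∈ s, α i) = ∏ i ∈ s, D.absVal (α i) := map_prod D.absHom α s

theorem absVal_t (γ : Γ) : D.absVal (D.t (Multiplicative.ofAdd γ)) = X γ := by
  have h : D.val (D.t (Multiplicative.ofAdd γ)) = γ := by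
    rw [val_eq_iff]
    exact D.ν_t γ
  have h1 := D.tt_mul_tt_neg γ
  rw [absVal, h]
  change algebraMap ℂ (CField Γ) (residueAbs (D.residue (D.tt γ * D.tt (-γ))) : ℂ) * X γ = X γ
  rw [h1, residue_one, residueAbs_one]
  simp

end AbsVal

end SplitValuation

namespace SplitValuation

variable {F Γ κ : Type*} [Field F] [AddCommGroup Γ] [LinearOrder Γ] [IsOrderedAddMonoid Γ]

/-! ### Lifts as functions on balls of `F` -/

section Lift

variable [Field κ] (D : SplitValuation F Γ κ)

theorem lift_eq_zero {g : κ → ℂ} {a : F} {γ : Γ} {x : F} (h : D.ν (x - a) < γ) :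
    D.lift g a γ x = 0 :=
  if_neg fun h' => not_le_of_gt h ((D.nonneg_mul_tt_neg _ _).1 h')

theorem lift_eq_of_le {g : κ → ℂ} {a : F} {γ : Γ} {x : F} (h : (γ : WithTop Γ) ≤ D.ν (x - a)) :
    D.lift g a γ x = algebraMap ℂ (CField Γ) (g (D.residue ((x - a) * D.tt (-γ)))) :=
  if_pos ((D.nonneg_mul_tt_neg _ _).2 h)

/-- A lift is invariant under small translations. -/
theorem lift_congr {g : κ → ℂ} {a : F} {γ : Γ} {x y : F} (h : (γ : WithTop Γ) < D.ν (x - y)) :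
    D.lift g a γ x = D.lift g a γ y := by
  have e : x - a = (x - y) + (y - a) := by ring
  rcases lt_or_ge (D.ν (y - a)) γ with hy | hy
  · rw [D.lift_eq_zero hy, D.lift_eq_zero]
    rwa [e, D.ν.map_add_eq_of_lt_right (hy.trans h)]
  · have hx : (γ : WithTop Γ) ≤ D.ν (x - a) := by
      rw [e]
      exact D.ν.map_le_add h.le hy
    rw [D.lift_eq_of_le hy, D.lift_eq_of_le hx, e, add_mul,
      D.residue_add ((D.nonneg_mul_tt_neg _ _).2 h.le) ((D.nonneg_mul_tt_neg _ _).2 hy),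
      D.residue_eq_zero ((D.pos_mul_tt_neg _ _).2 h), zero_add]

/-- Lifts from the same ball differ by a translation of `κ`. -/
theorem lift_translate {g : κ → ℂ} {a b : F} {γ : Γ} {x : F} (hb : (γ : WithTop Γ) ≤ D.ν (b - a))
    (hx : (γ : WithTop Γ) ≤ D.ν (x - b)) :
    D.lift g a γ x = algebraMap ℂ (CField Γ)
      (g (D.residue ((x - b) * D.tt (-γ)) + D.residue ((b - a) * D.tt (-γ)))) := by
  have e : x - a = (x - b) + (b - a) := by ring
  have hxa : (γ : WithTop Γ) ≤ D.ν (x - a) := by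
    rw [e]
    exact D.ν.map_le_add hx hb
  rw [D.lift_eq_of_le hxa, e, add_mul, D.residue_add ((D.nonneg_mul_tt_neg _ _).2 hx)
    ((D.nonneg_mul_tt_neg _ _).2 hb)]

end Lift

/-! ### Existence and linearity of the integral on `F` -/

section Integral

variable [NontriviallyNormedField κ] [LocallyCompactSpace κ] [MeasurableSpace κ] [BorelSpace κ]
  (D : SplitValuation F Γ κ) (μ : Measure κ) [μ.IsAddHaarMeasure]

/-- A linear relation with constant term between translates of integrable functions on `κ`,
with coefficients in `ℂ(Γ)`: the constant term and the integral vanish. -/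
theorem sum_translates_eq_const {ι : Type*} (s : Finset ι) (c : ι → CField Γ) (g : ι → κ → ℂ)
    (b : ι → κ) (K : CField Γ) (hg : ∀ i ∈ s, Integrable (g i) μ)
    (h : ∀ u, ∑ i ∈ s, c i * algebraMap ℂ (CField Γ) (g i (u + b i)) = K) :
    K = 0 ∧ ∑ i ∈ s, c i * algebraMap ℂ (CField Γ) (∫ u, g i u ∂μ) = 0 := by
  -- Complex linear functionals separate the points of `ℂ(Γ)`, so they reduce the claim to
  -- complex-valued functions, where Haar integration applies.
  have key : ∀ ℓ : CField Γ →ₗ[ℂ] ℂ,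
      ℓ K = 0 ∧ ℓ (∑ i ∈ s, c i * algebraMap ℂ (CField Γ) (∫ u, g i u ∂μ)) = 0 := by
    intro ℓ
    have hmul : ∀ (i : ι) (z : ℂ), ℓ (c i * algebraMap ℂ (CField Γ) z) = z * ℓ (c i) := by
      intro i z
      rw [mul_comm, ← Algebra.smul_def, map_smul, smul_eq_mul]
    have h' : ∀ u, ∑ i ∈ s, g i (u + b i) * ℓ (c i) = ℓ K := by
      intro u
      rw [← h u, map_sum]
      exact Finset.sum_congr rfl fun i _ => (hmul i _).symm
    have hint : ∀ i ∈ s, Integrable (fun u => g i (u + b i) * ℓ (c i)) μ := fun i hi =>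
      ((hg i hi).comp_add_right (b i)).mul_const _
    have hK : Integrable (fun _ : κ => ℓ K) μ := by
      have := integrable_finsetSum s hint
      simpa only [h'] using this
    -- A constant is integrable only if it vanishes, since `κ` is not compact and so has infinite
    -- measure.
    have hK0 : ℓ K = 0 := by
      rcases integrable_const_iff.1 hK with h0 | h0
      · exact h0
      · have := measure_univ_of_isAddLeftInvariant μ
        exact absurd (measure_lt_top μ Set.univ) (by simp [this])
    refine ⟨hK0, ?_⟩
    have h2 : ∫ u, ∑ i ∈ s, g i (u + b i) * ℓ (c i) ∂μ = 0 := by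
      simp [h', hK0]
    rw [integral_finsetSum s hint] at h2
    rw [map_sum, ← h2]
    refine Finset.sum_congr rfl fun i _ => ?_
    rw [hmul, integral_mul_const, integral_add_right_eq_self (g i)]
  constructor
  · by_contra h0
    obtain ⟨ℓ, hℓ⟩ := Module.Projective.exists_dual_ne_zero ℂ h0
    exact hℓ (key ℓ).1
  · by_contra h0
    obtain ⟨ℓ, hℓ⟩ := Module.Projective.exists_dual_ne_zero ℂ h0
    exact hℓ (key ℓ).2

/-- A linear relation between lifts is inherited by their integrals. -/
theorem sum_integral_eq_zero {ι : Type*} (s : Finset ι) (c : ι → CField Γ) (g : ι → κ → ℂ)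
    (a : ι → F) (γ : ι → Γ) (hg : ∀ i ∈ s, Integrable (g i) μ)
    (h : ∀ x, ∑ i ∈ s, c i * D.lift (g i) (a i) (γ i) x = 0) :
    ∑ i ∈ s, c i * (algebraMap ℂ (CField Γ) (∫ u, g i u ∂μ) * X (γ i)) = 0 := by
  classical
  induction s using Finset.strongInduction with
  | H s ih =>
  rcases s.eq_empty_or_nonempty with rfl | hs
  · simp
  -- Maximal `γ` means a ball of least radius; `P` selects the lifts attached to this same ball.
  obtain ⟨i₀, hi₀, hmax⟩ := s.exists_max_image γ hs
  let P : ι → Prop := fun i => γ i = γ i₀ ∧ (γ i₀ : WithTop Γ) ≤ D.ν (a i₀ - a i)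
  have hP₀ : P i₀ := ⟨rfl, by simp⟩
  have hsplit : ∀ f : ι → CField Γ,
      ∑ i ∈ s, f i = ∑ i ∈ s with P i, f i + ∑ i ∈ s with ¬ P i, f i := fun f =>
    (Finset.sum_filter_add_sum_filter_not s P f).symm
  -- A lift of strictly larger radius is constant on the small ball; one of equal radius attached to
  -- a different ball vanishes there, the two balls being disjoint.
  have hconst : ∀ i ∈ s, ¬ P i → ∀ x, (γ i₀ : WithTop Γ) ≤ D.ν (x - a i₀) →
      D.lift (g i) (a i) (γ i) x = D.lift (g i) (a i) (γ i) (a i₀) := by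
    intro i hi hPi x hx
    rcases (hmax i hi).lt_or_eq with hlt | heq
    · exact D.lift_congr ((WithTop.coe_lt_coe.2 hlt).trans_le hx)
    · have hlt : D.ν (a i₀ - a i) < γ i := by
        rw [heq]
        exact lt_of_not_ge fun h' => hPi ⟨heq, h'⟩
      rw [D.lift_eq_zero hlt, D.lift_eq_zero]
      have e : x - a i = (x - a i₀) + (a i₀ - a i) := by ring
      rwa [e, D.ν.map_add_eq_of_lt_right (hlt.trans_le (heq ▸ hx))]
  have hrest : ∀ x, (γ i₀ : WithTop Γ) ≤ D.ν (x - a i₀) →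
      ∑ i ∈ s with ¬ P i, c i * D.lift (g i) (a i) (γ i) x =
        ∑ i ∈ s with ¬ P i, c i * D.lift (g i) (a i) (γ i) (a i₀) := fun x hx =>
    Finset.sum_congr rfl fun i hi => by
      rw [hconst i (Finset.mem_filter.1 hi).1 (Finset.mem_filter.1 hi).2 x hx]
  have hloc : ∀ i ∈ s.filter P, ∀ x, (γ i₀ : WithTop Γ) ≤ D.ν (x - a i₀) →
      D.lift (g i) (a i) (γ i) x = algebraMap ℂ (CField Γ)
        (g i (D.residue ((x - a i₀) * D.tt (-γ i₀)) +
          D.residue ((a i₀ - a i) * D.tt (-γ i₀)))) := by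
    intro i hi x hx
    obtain ⟨-, h1, h2⟩ := Finset.mem_filter.1 hi
    rw [h1]
    exact D.lift_translate h2 hx
  -- On the small ball the relation depends only on the residue `u` of `(x - a i₀) t(-γ i₀)`;
  -- differences of centres become translations of `κ`.
  obtain ⟨hK, hint⟩ := sum_translates_eq_const μ (s.filter P) c g
    (fun i => D.residue ((a i₀ - a i) * D.tt (-γ i₀)))
    (-∑ i ∈ s with ¬ P i, c i * D.lift (g i) (a i) (γ i) (a i₀))
    (fun i hi => hg i (Finset.mem_filter.1 hi).1) (by
      intro u
      obtain ⟨y, hy, rfl⟩ := D.exists_residue_eq u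
      have hx := h (a i₀ + y * D.tt (γ i₀))
      have e : (a i₀ + y * D.tt (γ i₀) - a i₀) * D.tt (-γ i₀) = y := by
        rw [add_sub_cancel_left, mul_assoc, tt_mul_tt_neg, mul_one]
      have hle : (γ i₀ : WithTop Γ) ≤ D.ν (a i₀ + y * D.tt (γ i₀) - a i₀) := by
        rw [← D.nonneg_mul_tt_neg, e]
        exact hy
      rw [hsplit, add_eq_zero_iff_eq_neg, hrest _ hle] at hx
      rw [← hx]
      refine Finset.sum_congr rfl fun i hi => ?_
      rw [hloc i hi _ hle, e])
  -- Off the ball every term vanishes; on it the complementary sum is the constant just shown to be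
  -- zero.
  have hP : ∀ x, ∑ i ∈ s with P i, c i * D.lift (g i) (a i) (γ i) x = 0 := by
    intro x
    rcases lt_or_ge (D.ν (x - a i₀)) (γ i₀) with hx | hx
    · refine Finset.sum_eq_zero fun i hi => ?_
      obtain ⟨-, h1, h2⟩ := Finset.mem_filter.1 hi
      have e : x - a i = (x - a i₀) + (a i₀ - a i) := by ring
      rw [D.lift_eq_zero, mul_zero]
      rwa [e, D.ν.map_add_eq_of_lt_left (hx.trans_le h2), h1]
    · have hx0 := h x
      rw [hsplit, hrest x hx, neg_eq_zero.1 hK, add_zero] at hx0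
      exact hx0
  rw [hsplit, ih (s.filter fun i => ¬ P i) (Finset.filter_ssubset.2 ⟨i₀, hi₀, not_not.2 hP₀⟩)
    (fun i hi => hg i (Finset.mem_filter.1 hi).1) (fun x => by
      have := h x
      rwa [hsplit, hP, zero_add] at this), add_zero]
  rw [Finset.sum_congr rfl fun i hi => by
    rw [(Finset.mem_filter.1 hi).2.1, ← mul_assoc], ← Finset.sum_mul, hint, zero_mul]

/-- The difference of the two pairs has first component zero. It is thus a relation between lifts,
with the factors `X^δ` absorbed in the coefficients. -/
theorem integralGraph_unique {f : F → CField Γ} {c c' : CField Γ}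
    (h : (f, c) ∈ D.integralGraph μ) (h' : (f, c') ∈ D.integralGraph μ) : c = c' := by
  have h0 := Submodule.sub_mem _ h h'
  rw [Prod.mk_sub_mk, sub_self, integralGraph, Submodule.mem_span_set'] at h0
  obtain ⟨n, k, p, hp⟩ := h0
  choose g a γ δ hg hpe using fun i => (p i).2
  rw [Finset.sum_congr rfl fun i _ => by rw [hpe i]] at hp
  have h1 := congrArg Prod.fst hp
  have h2 := congrArg Prod.snd hp
  rw [Prod.fst_sum] at h1
  rw [Prod.snd_sum] at h2
  have := D.sum_integral_eq_zero μ Finset.univ (fun i => k i * X (δ i)) g a γ (fun i _ => hg i)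
    (fun x => by
      have hx := congrFun h1 x
      rw [Finset.sum_apply] at hx
      simp only [Prod.smul_mk, Pi.smul_apply, smul_eq_mul, Pi.zero_apply] at hx
      rw [← hx]
      exact Finset.sum_congr rfl fun i _ => by ring)
  rw [← sub_eq_zero, ← this]
  refine h2.symm.trans ?_
  refine Finset.sum_congr rfl fun i _ => ?_
  simp only [Prod.smul_mk, smul_eq_mul]
  ring

theorem integral_eq {f : F → CField Γ} {c : CField Γ} (h : (f, c) ∈ D.integralGraph μ) :
    D.integral μ f = c := by
  have hex : ∃ c, (f, c) ∈ D.integralGraph μ := ⟨c, h⟩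
  rw [integral, dif_pos hex]
  exact D.integralGraph_unique μ hex.choose_spec h

omit [LocallyCompactSpace κ] [BorelSpace κ] [μ.IsAddHaarMeasure] in
theorem mem_integrableFun_iff {f : F → CField Γ} :
    f ∈ D.integrableFun μ ↔ ∃ c, (f, c) ∈ D.integralGraph μ := by
  have : D.integrableFun μ =
      (D.integralGraph μ).map (LinearMap.fst (CField Γ) (F → CField Γ) (CField Γ)) := by
    rw [integrableFun, integralGraph, Submodule.map_span]
    congr 1
    ext f
    constructor
    · rintro ⟨g, a, γ, δ, hg, rfl⟩
      exact ⟨_, ⟨g, a, γ, δ, hg, rfl⟩, rfl⟩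
    · rintro ⟨_, ⟨g, a, γ, δ, hg, rfl⟩, rfl⟩
      exact ⟨g, a, γ, δ, hg, rfl⟩
  rw [this, Submodule.mem_map]
  constructor
  · rintro ⟨⟨f, c⟩, h, rfl⟩
    exact ⟨c, h⟩
  · rintro ⟨c, h⟩
    exact ⟨_, h, rfl⟩

theorem mem_integralGraph {f : F → CField Γ} (h : f ∈ D.integrableFun μ) :
    (f, D.integral μ f) ∈ D.integralGraph μ := by
  obtain ⟨c, hc⟩ := (D.mem_integrableFun_iff μ).1 h
  rwa [D.integral_eq μ hc]

theorem integral_add {f f' : F → CField Γ} (h : f ∈ D.integrableFun μ)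
    (h' : f' ∈ D.integrableFun μ) :
    D.integral μ (f + f') = D.integral μ f + D.integral μ f' :=
  D.integral_eq μ (Submodule.add_mem _ (D.mem_integralGraph μ h) (D.mem_integralGraph μ h'))

theorem integral_smul {f : F → CField Γ} (k : CField Γ) (h : f ∈ D.integrableFun μ) :
    D.integral μ (k • f) = k * D.integral μ f :=
  D.integral_eq μ (Submodule.smul_mem _ k (D.mem_integralGraph μ h))

theorem integral_zero : D.integral μ 0 = 0 := D.integral_eq μ (Submodule.zero_mem _)

omit [LocallyCompactSpace κ] [BorelSpace κ] [μ.IsAddHaarMeasure] in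
theorem lift_mem_integralGraph {g : κ → ℂ} (a : F) (γ : Γ) (hg : Integrable g μ) :
    (D.lift g a γ, algebraMap ℂ (CField Γ) (∫ u, g u ∂μ) * X γ) ∈ D.integralGraph μ :=
  Submodule.subset_span ⟨g, a, γ, 0, hg, by simp only [X_zero, mul_one]⟩

omit [LocallyCompactSpace κ] [BorelSpace κ] [μ.IsAddHaarMeasure] in
/-- Integrable functions are uniformly locally constant. -/
theorem exists_forall_congr_of_mem_integrableFun {f : F → CField Γ}
    (h : f ∈ D.integrableFun μ) :
    ∃ γ : Γ, ∀ x y, (γ : WithTop Γ) < D.ν (x - y) → f x = f y := by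
  induction h using Submodule.span_induction with
  | mem f h =>
    obtain ⟨g, a, γ, δ, -, rfl⟩ := h
    exact ⟨γ, fun x y hxy => by simp only [D.lift_congr hxy]⟩
  | zero => exact ⟨0, fun _ _ _ => rfl⟩
  | add f f' _ _ ih ih' =>
    obtain ⟨γ, hγ⟩ := ih
    obtain ⟨γ', hγ'⟩ := ih'
    refine ⟨max γ γ', fun x y hxy => ?_⟩
    rw [Pi.add_apply, Pi.add_apply,
      hγ x y ((WithTop.coe_le_coe.2 (le_max_left _ _)).trans_lt hxy),
      hγ' x y ((WithTop.coe_le_coe.2 (le_max_right _ _)).trans_lt hxy)]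
  | smul k f _ ih =>
    obtain ⟨γ, hγ⟩ := ih
    exact ⟨γ, fun x y hxy => by rw [Pi.smul_apply, Pi.smul_apply, hγ x y hxy]⟩

/-- For non-trivial `Γ` such a function is zero, being constant on balls of some fixed radius, which
are infinite. For trivial `Γ` it is a combination of indicators of points, which are null for Haar
measure. -/
theorem integral_of_finite_support {f : F → CField Γ} (h : f ∈ D.integrableFun μ)
    (hf : f.support.Finite) : D.integral μ f = 0 := by
  classical
  rcases subsingleton_or_nontrivial Γ with hΓ | hΓ
  · have hnonneg : ∀ x : F, 0 ≤ D.ν x := by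
      intro x
      induction D.ν x using WithTop.recTopCoe with
      | top => exact le_top
      | coe γ => rw [Subsingleton.elim γ 0, WithTop.coe_zero]
    -- As `Γ` is trivial, non-zero elements have value zero and hence non-zero residue. The residue
    -- map is therefore injective on `F`.
    have hpt : ∀ (x y : F),
        D.lift (Set.indicator {D.residue y} fun _ => (1 : ℂ)) 0 0 x = if x = y then 1 else 0 := by
      intro x y
      rw [D.lift_eq_of_le (by simpa using hnonneg x), neg_zero, tt_zero, sub_zero, mul_one]
      split_ifs with hxy
      · simp [hxy]
      · rw [Set.indicator_of_notMem, map_zero]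
        intro he
        refine hxy (sub_eq_zero.1 (by_contra fun hne => ?_))
        refine D.residue_ne_zero (x := x - y) ?_ ?_
        · change D.ν (Units.mk0 _ hne : Fˣ) = 0
          rw [← D.coe_val, Subsingleton.elim (D.val _) 0, WithTop.coe_zero]
        · rw [D.residue_sub (hnonneg x) (hnonneg y), Set.mem_singleton_iff.1 he, sub_self]
    have hind : ∀ y : F, (D.lift (Set.indicator {D.residue y} fun _ => (1 : ℂ)) 0 0,
        (0 : CField Γ)) ∈ D.integralGraph μ := by
      intro y
      have hm : μ {D.residue y} = 0 := measure_singleton _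
      have := D.lift_mem_integralGraph μ (0 : F) 0
        (g := Set.indicator {D.residue y} fun _ => (1 : ℂ))
        ((integrable_indicator_iff (measurableSet_singleton _)).2 (by
          simp [IntegrableOn, Measure.restrict_eq_zero.2 hm]))
      rwa [integral_indicator (measurableSet_singleton _), Measure.restrict_eq_zero.2 hm,
        integral_zero_measure, map_zero, zero_mul] at this
    have hsum := Submodule.sum_mem (D.integralGraph μ) (t := hf.toFinset)
      fun y _ => Submodule.smul_mem _ (f y) (hind y)
    refine D.integral_eq μ ?_
    convert hsum using 1
    refine Prod.ext ?_ ?_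
    · rw [Prod.fst_sum]
      funext x
      rw [Finset.sum_apply]
      simp only [Prod.smul_mk, Pi.smul_apply, smul_eq_mul, hpt, mul_ite, mul_one, mul_zero]
      rw [Finset.sum_ite_eq]
      split_ifs with hx
      · rfl
      · simpa using hx
    · rw [Prod.snd_sum]
      simp
  · obtain ⟨γ, hγ⟩ := D.exists_forall_congr_of_mem_integrableFun μ h
    have hf0 : f = 0 := by
      funext x
      by_contra hx
      -- The points `x + t(δ)` with `δ > γ` are infinitely many, and `f` takes the value `f x` at
      -- each.
      have hinj : Function.Injective fun δ : Γ => x + D.tt δ := by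
        intro δ δ' hδ
        have := congrArg D.ν (add_left_cancel hδ)
        rwa [ν_tt, ν_tt, WithTop.coe_inj] at this
      refine (Set.Ioi_infinite γ).image hinj.injOn (hf.subset ?_)
      rintro _ ⟨δ, hδ, rfl⟩
      rw [Function.mem_support, hγ _ x]
      · exact hx
      · rw [add_sub_cancel_left, ν_tt]
        exact WithTop.coe_lt_coe.2 hδ
    rw [hf0, D.integral_zero μ]

end Integral

end SplitValuation

section HasRepeatedIntegral

/-! ### Uniqueness of repeated integrals -/

theorem HasRepeatedIntegral.unique {A C : Type*} [Nonempty A] {L : Set (A → C)}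
    {I : (A → C) → C} {n : ℕ} {f : (Fin n → A) → C} {c c' : C}
    (h : HasRepeatedIntegral L I n f c) (h' : HasRepeatedIntegral L I n f c') : c = c' := by
  induction n with
  | zero => exact h.symm.trans h'
  | succ n ih => exact ih (h 0).2 (h' 0).2

end HasRepeatedIntegral

/-! ### Linear automorphisms adapted to one coordinate -/

section InsertNth

variable {k : Type*} [Field k] {n : ℕ}

/-- The linear automorphism of `k ^ (n + 1)` acting by `e` on the coordinates other than the
`j`-th one. -/
def insertNthCongr (j : Fin (n + 1)) (e : (Fin n → k) ≃ₗ[k] (Fin n → k)) :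
    (Fin (n + 1) → k) ≃ₗ[k] (Fin (n + 1) → k) where
  toFun w := j.insertNth (α := fun _ => k) (w j) (e (j.removeNth w))
  invFun w := j.insertNth (α := fun _ => k) (w j) (e.symm (j.removeNth w))
  map_add' v w := by
    have : j.removeNth (v + w) = j.removeNth v + j.removeNth w := rfl
    rw [this, map_add, ← Fin.insertNth_add]
    rfl
  map_smul' c w := by
    have : j.removeNth (c • w) = c • j.removeNth w := rfl
    rw [this, map_smul]
    funext i
    cases i using j.succAboveCases <;> simp
  left_inv w := by simp
  right_inv w := by simp

theorem insertNthCongr_insertNth (j : Fin (n + 1)) (e : (Fin n → k) ≃ₗ[k] (Fin n → k)) (u : k)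
    (z : Fin n → k) :
    insertNthCongr j e (j.insertNth (α := fun _ => k) u z) =
      j.insertNth (α := fun _ => k) u (e z) := by
  simp [insertNthCongr]

/-- The shear of `k ^ n` adding `q` times the `j`-th coordinate. -/
def shear (j : Fin n) (q : Fin n → k) (hq : q j = 0) : (Fin n → k) ≃ₗ[k] (Fin n → k) where
  toFun w := w + w j • q
  invFun w := w - w j • q
  map_add' v w := by
    simp only [Pi.add_apply, add_smul]
    abel
  map_smul' c w := by simp [mul_smul]
  left_inv w := by simp [hq]
  right_inv w := by simp [hq]

theorem shear_apply (j : Fin n) (q : Fin n → k) (hq : q j = 0) (w : Fin n → k) :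
    shear j q hq w = w + w j • q := rfl

theorem shear_insertNth (j : Fin (n + 1)) (q : Fin (n + 1) → k) (hq : q j = 0) (u : k)
    (z : Fin n → k) :
    shear j q hq (j.insertNth (α := fun _ => k) u z) =
      j.insertNth (α := fun _ => k) u (z + u • j.removeNth q) := by
  funext i
  cases i using j.succAboveCases with
  | x => simp [shear_apply, hq]
  | p i => simp [shear_apply, Fin.removeNth]

end InsertNth

section InsertNthMeasure

variable {κ : Type*} [MeasurableSpace κ] {μ : Measure κ} [SigmaFinite μ] {n : ℕ}

theorem integrable_insertNth {g : (Fin (n + 1) → κ) → ℂ}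
    (hg : Integrable g (Measure.pi fun _ => μ)) (j : Fin (n + 1)) :
    Integrable (fun p : κ × (Fin n → κ) => g (j.insertNth (α := fun _ => κ) p.1 p.2))
      (μ.prod (Measure.pi fun _ => μ)) :=
  (measurePreserving_piFinSuccAbove (fun _ => μ) j).symm.integrable_comp_of_integrable hg

theorem integral_insertNth (g : (Fin (n + 1) → κ) → ℂ) (j : Fin (n + 1)) :
    ∫ p : κ × (Fin n → κ), g (j.insertNth (α := fun _ => κ) p.1 p.2)
      ∂(μ.prod (Measure.pi fun _ => μ)) = ∫ w, g w ∂(Measure.pi fun _ => μ) :=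
  (measurePreserving_piFinSuccAbove (fun _ => μ) j).symm.integral_comp' g

end InsertNthMeasure

/-! ### GL-Fubini functions on `κ^n` -/

section Residue

variable {κ : Type*} [NontriviallyNormedField κ] [MeasurableSpace κ] {μ : Measure κ} {n : ℕ}

theorem IsGLFubini.comp_linearEquiv {g : (Fin n → κ) → ℂ} (hg : IsGLFubini μ n g)
    (e : (Fin n → κ) ≃ₗ[κ] (Fin n → κ)) : IsFubiniResidue μ n (fun u => g (e u)) := by
  have h := hg (Matrix.GeneralLinearGroup.toLin.symm
    (LinearMap.GeneralLinearGroup.ofLinearEquiv e))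
  have he : ∀ u, ((Matrix.GeneralLinearGroup.toLin.symm
      (LinearMap.GeneralLinearGroup.ofLinearEquiv e) : GL (Fin n) κ) :
        Matrix (Fin n) (Fin n) κ) *ᵥ u = e u := by
    intro u
    rw [← Matrix.mulVecLin_apply]
    have := Matrix.GeneralLinearGroup.coe_toLin (Matrix.GeneralLinearGroup.toLin.symm
      (LinearMap.GeneralLinearGroup.ofLinearEquiv e))
    rw [MulEquiv.apply_symm_apply] at this
    rw [← this]
    rfl
  simpa only [he] using h

theorem isGLFubini_iff {g : (Fin n → κ) → ℂ} : IsGLFubini μ n g ↔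
    ∀ e : (Fin n → κ) ≃ₗ[κ] (Fin n → κ), IsFubiniResidue μ n (fun u => g (e u)) := by
  refine ⟨fun h e => h.comp_linearEquiv e, fun h τ => ?_⟩
  exact h (Matrix.GeneralLinearGroup.toLin τ).toLinearEquiv

theorem IsGLFubini.comp {g : (Fin n → κ) → ℂ} (hg : IsGLFubini μ n g)
    (e : (Fin n → κ) ≃ₗ[κ] (Fin n → κ)) : IsGLFubini μ n (fun u => g (e u)) :=
  isGLFubini_iff.2 fun e' => hg.comp_linearEquiv (e'.trans e)

theorem IsGLFubini.integrable {g : (Fin n → κ) → ℂ} (hg : IsGLFubini μ n g) :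
    Integrable g (Measure.pi fun _ => μ) :=
  (hg.comp_linearEquiv (LinearEquiv.refl κ _)).1

theorem IsGLFubini.integrable_section {g : (Fin (n + 1) → κ) → ℂ}
    (hg : IsGLFubini μ (n + 1) g) (j : Fin (n + 1)) (z : Fin n → κ) :
    Integrable (fun u => g (j.insertNth (α := fun _ => κ) u z)) μ := by
  obtain ⟨-, c, hc⟩ := hg.comp_linearEquiv (LinearEquiv.refl κ _)
  exact (hc j).1 z

variable [SigmaFinite μ]

/-- An automorphism of the remaining coordinates extends by the identity on the `j`-th one, so the
GL condition is inherited by partial integrals. -/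
theorem IsGLFubini.integral_section {g : (Fin (n + 1) → κ) → ℂ} (hg : IsGLFubini μ (n + 1) g)
    (j : Fin (n + 1)) :
    IsGLFubini μ n (fun z => ∫ u, g (j.insertNth (α := fun _ => κ) u z) ∂μ) := by
  refine isGLFubini_iff.2 fun e => ?_
  obtain ⟨h1, c, hc⟩ := hg.comp_linearEquiv (insertNthCongr j e)
  refine ⟨?_, c, ?_⟩
  · have := (integrable_insertNth h1 j).integral_prod_right
    simpa only [insertNthCongr_insertNth] using this
  · have := (hc j).2
    simpa only [insertNthCongr_insertNth] using this

theorem IsGLFubini.integral_integral_section {g : (Fin (n + 1) → κ) → ℂ}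
    (hg : IsGLFubini μ (n + 1) g) (j : Fin (n + 1)) :
    ∫ z, ∫ u, g (j.insertNth (α := fun _ => κ) u z) ∂μ ∂(Measure.pi fun _ => μ) =
      ∫ w, g w ∂(Measure.pi fun _ => μ) := by
  rw [← integral_insertNth g j, integral_prod_symm _ (integrable_insertNth hg.integrable j)]

/-- With the `j`-th coordinate fixed, a shear translates the other coordinates, and Haar measure is
translation invariant. -/
theorem IsGLFubini.integral_shear [μ.IsAddLeftInvariant] [BorelSpace κ] [SecondCountableTopology κ]
    {g : (Fin (n + 1) → κ) → ℂ} (hg : IsGLFubini μ (n + 1) g) (j : Fin (n + 1))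
    (q : Fin (n + 1) → κ) (hq : q j = 0) :
    ∫ w, g (shear j q hq w) ∂(Measure.pi fun _ => μ) = ∫ w, g w ∂(Measure.pi fun _ => μ) := by
  rw [← integral_insertNth g j, integral_prod _ (integrable_insertNth hg.integrable j),
    ← integral_insertNth _ j,
    integral_prod _ (integrable_insertNth (hg.comp (shear j q hq)).integrable j)]
  simp only [shear_insertNth]
  congr 1
  funext u
  exact integral_add_right_eq_self
    (fun z => g (j.insertNth (α := fun _ => κ) u z)) (u • j.removeNth q)

end Residue

namespace SplitValuation

variable {F Γ κ : Type*} [Field F] [AddCommGroup Γ] [LinearOrder Γ] [IsOrderedAddMonoid Γ]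

/-! ### Integral shears and pivots -/

section LiftInt

variable [Field κ] (D : SplitValuation F Γ κ) {n : ℕ}

open Classical in
/-- The lift of `g : κ ^ n → ℂ` to `F ^ n`, supported on the integral vectors. -/
def liftInt (g : (Fin n → κ) → ℂ) (y : Fin n → F) : CField Γ :=
  if ∀ i, 0 ≤ D.ν (y i) then algebraMap ℂ (CField Γ) (g fun i => D.residue (y i)) else 0

theorem liftInt_of_nonneg {g : (Fin n → κ) → ℂ} {y : Fin n → F} (h : ∀ i, 0 ≤ D.ν (y i)) :
    D.liftInt g y = algebraMap ℂ (CField Γ) (g fun i => D.residue (y i)) := if_pos h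

theorem liftInt_of_not {g : (Fin n → κ) → ℂ} {y : Fin n → F} (h : ¬ ∀ i, 0 ≤ D.ν (y i)) :
    D.liftInt g y = 0 := if_neg h

theorem liftPi_eq_liftInt (g : (Fin n → κ) → ℂ) (a : Fin n → F) (γ : Fin n → Γ) (x : Fin n → F) :
    D.liftPi g a γ x = D.liftInt g fun i => (x i - a i) * D.tt (-γ i) := rfl

/-- The shear and its inverse both have integral entries, so it preserves integrality of vectors in
both directions and commutes with reduction. -/
theorem liftInt_shear (g : (Fin n → κ) → ℂ) (j : Fin n) (q : Fin n → F) (hq : q j = 0)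
    (hq0 : ∀ i, 0 ≤ D.ν (q i)) (hr : D.residue (q j) = 0) (w : Fin n → F) :
    D.liftInt g (shear j q hq w) =
      D.liftInt (fun u => g (shear j (fun i => D.residue (q i)) hr u)) w := by
  have hj : shear j q hq w j = w j := by simp [shear_apply, hq]
  have hi : ∀ i, shear j q hq w i = w i + w j * q i := fun i => rfl
  by_cases hw : ∀ i, 0 ≤ D.ν (w i)
  · have hw' : ∀ i, 0 ≤ D.ν (shear j q hq w i) := fun i =>
      D.nonneg_add (hw i) (D.nonneg_mul (hw j) (hq0 i))
    rw [D.liftInt_of_nonneg hw, D.liftInt_of_nonneg hw']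
    congr 2
    funext i
    rw [hi, D.residue_add (hw i) (D.nonneg_mul (hw j) (hq0 i)), D.residue_mul (hw j) (hq0 i)]
    rfl
  · rw [D.liftInt_of_not hw, D.liftInt_of_not]
    intro hw'
    refine hw fun i => ?_
    have hj0 : 0 ≤ D.ν (w j) := hj ▸ hw' j
    have e : w i = shear j q hq w i - w j * q i := by rw [hi, add_sub_cancel_right]
    rw [e]
    exact D.nonneg_sub (hw' i) (D.nonneg_mul hj0 (hq0 i))

/-- An entry of least valuation in the column divides all the others within the ring of integers; it
is non-zero because the column is. -/
theorem exists_pivot (M : Matrix (Fin (n + 1)) (Fin (n + 1)) F) (hM : M.det ≠ 0)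
    (r : Fin (n + 1)) : ∃ j, M j r ≠ 0 ∧ ∀ i, 0 ≤ D.ν (M i r / M j r) := by
  obtain ⟨j, hj⟩ := Finite.exists_min fun i => D.ν (M i r)
  have hj0 : M j r ≠ 0 := by
    intro h0
    refine hM (Matrix.det_eq_zero_of_column_eq_zero r fun i => ?_)
    have := hj i
    rw [h0, D.ν.map_zero, top_le_iff, D.ν.top_iff] at this
    exact this
  refine ⟨j, hj0, fun i => ?_⟩
  have hi := hj i
  have e : D.ν (M i r) = D.ν (M i r / M j r) + D.ν (M j r) := by
    rw [← D.ν.map_mul, div_mul_cancel₀ _ hj0]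
  rw [e] at hi
  refine WithTop.le_of_add_le_add_right ((D.ν.ne_top_iff).2 hj0) ?_
  rwa [zero_add]

end LiftInt

/-! ### Repeated integrals of lifts -/

section HasIntegral

variable [NontriviallyNormedField κ] [LocallyCompactSpace κ] [MeasurableSpace κ] [BorelSpace κ]
  (D : SplitValuation F Γ κ) (μ : Measure κ) [μ.IsAddHaarMeasure] {n : ℕ}

omit [LocallyCompactSpace κ] [BorelSpace κ] [μ.IsAddHaarMeasure] in
theorem HasIntegralPi.unique {f : (Fin n → F) → CField Γ} {c c' : CField Γ}
    (h : D.HasIntegralPi μ f c) (h' : D.HasIntegralPi μ f c') : c = c' :=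
  HasRepeatedIntegral.unique h h'

omit [LocallyCompactSpace κ] [BorelSpace κ] [μ.IsAddHaarMeasure] in
theorem HasIntegralPi.integralPi_eq {f : (Fin n → F) → CField Γ} {c : CField Γ}
    (h : D.HasIntegralPi μ f c) : D.integralPi μ f = c := by
  have hf : D.IsFubini μ f := ⟨c, h⟩
  rw [integralPi, dif_pos hf]
  exact HasIntegralPi.unique D μ hf.choose_spec h

omit [LocallyCompactSpace κ] [BorelSpace κ] [μ.IsAddHaarMeasure] in
theorem HasIntegralPi.congr {f f' : (Fin n → F) → CField Γ} {c : CField Γ}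
    (h : D.HasIntegralPi μ f c) (hf : ∀ y, f' y = f y) : D.HasIntegralPi μ f' c := by
  rwa [funext hf]

theorem HasIntegralPi.zero : D.HasIntegralPi μ (0 : (Fin n → F) → CField Γ) 0 := by
  induction n with
  | zero => rfl
  | succ n ih =>
    intro r
    refine ⟨fun y => Submodule.zero_mem _, ?_⟩
    exact ih.congr D μ fun y => D.integral_zero μ

theorem HasIntegralPi.add {f f' : (Fin n → F) → CField Γ} {c c' : CField Γ}
    (h : D.HasIntegralPi μ f c) (h' : D.HasIntegralPi μ f' c') :
    D.HasIntegralPi μ (f + f') (c + c') := by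
  induction n generalizing c c' with
  | zero => exact congrArg₂ (· + ·) h h'
  | succ n ih =>
    intro r
    refine ⟨fun y => Submodule.add_mem _ ((h r).1 y) ((h' r).1 y), ?_⟩
    exact (ih (h r).2 (h' r).2).congr D μ fun y => D.integral_add μ ((h r).1 y) ((h' r).1 y)

theorem HasIntegralPi.smul {f : (Fin n → F) → CField Γ} {c : CField Γ} (k : CField Γ)
    (h : D.HasIntegralPi μ f c) : D.HasIntegralPi μ (k • f) (k * c) := by
  induction n generalizing c with
  | zero => exact congrArg (k * ·) h
  | succ n ih =>
    intro r
    refine ⟨fun y => Submodule.smul_mem _ k ((h r).1 y), ?_⟩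
    exact (ih (h r).2).congr D μ fun y => D.integral_smul μ k ((h r).1 y)

/-- Integration of a lift in one coordinate after an affine substitution. -/
theorem liftInt_section_mem_integralGraph {h : (Fin (n + 1) → κ) → ℂ}
    (hh : IsGLFubini μ (n + 1) h) (j : Fin (n + 1)) (d : Fˣ) (e : F) (z : Fin n → F) :
    ((fun x : F => D.liftInt h (j.insertNth (α := fun _ => F) ((d : F) * x - e) z)),
      (D.absVal d)⁻¹ *
        D.liftInt (fun v => ∫ u, h (j.insertNth (α := fun _ => κ) u v) ∂μ) z) ∈
      D.integralGraph μ := by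
  by_cases hz : ∀ i, 0 ≤ D.ν (z i)
  · set d₀ : F := (d : F) * D.tt (-D.val d) with hd₀
    have hν : D.ν d₀ = 0 := D.ν_angular d
    have hu : D.residue d₀ ≠ 0 := D.residue_ne_zero hν
    set v : Fin n → κ := fun i => D.residue (z i)
    have hg := hh.integrable_section j v
    -- Since `d x - e = d₀ (x - e/d) t(ν(d))`, the section is the lift with centre `e/d` and level
    -- `-ν(d)` of a dilation by the residue of `d₀`. The dilation and the level together give the
    -- factor `|d|^{-1}`.
    have key := D.lift_mem_integralGraph μ (e / d) (-D.val d)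
      (integrable_comp_mul_left μ hu hg)
    convert key using 1
    refine Prod.ext ?_ ?_
    · funext x
      have hx : (d : F) * x - e = d₀ * ((x - e / d) * D.tt (-(-D.val d))) := by
        have := D.tt_mul_tt_neg (D.val d)
        have hd := d.ne_zero
        rw [hd₀, neg_neg]
        field_simp
        linear_combination (e - (d : F) * x) * this
      have hνx : D.ν ((d : F) * x - e) = D.ν ((x - e / d) * D.tt (-(-D.val d))) := by
        rw [hx, D.ν.map_mul, hν, zero_add]
      by_cases hxn : 0 ≤ D.ν ((d : F) * x - e)
      · have hxn' := hνx ▸ hxn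
        have hall : ∀ i, 0 ≤ D.ν (j.insertNth (α := fun _ => F) ((d : F) * x - e) z i) := by
          intro i
          cases i using j.succAboveCases with
          | x => simpa using hxn
          | p i => simpa using hz i
        dsimp only
        rw [D.liftInt_of_nonneg hall, D.lift_eq_of_le ((D.nonneg_mul_tt_neg _ _).1 hxn')]
        congr 2
        funext i
        cases i using j.succAboveCases with
        | x =>
          simp only [Fin.insertNth_apply_same]
          rw [hx, D.residue_mul hν.ge hxn']
        | p i => simp only [Fin.insertNth_apply_succAbove, v]
      · dsimp only
        rw [D.liftInt_of_not, D.lift_eq_zero]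
        · rw [← not_le, ← D.nonneg_mul_tt_neg, ← hνx]
          exact hxn
        · intro hall
          exact hxn (by simpa using hall j)
    · rw [D.liftInt_of_nonneg hz, integral_comp_mul_left μ hu
        (fun u => h (j.insertNth (α := fun _ => κ) u v)), map_mul, X_neg, absVal, mul_inv]
      rw [Complex.ofReal_inv, map_inv₀]
      ring
  · have h0 : (fun x : F => D.liftInt h (j.insertNth (α := fun _ => F) ((d : F) * x - e) z)) =
        0 := by
      funext x
      exact D.liftInt_of_not fun hall => hz fun i => by simpa using hall (j.succAbove i)
    rw [h0, D.liftInt_of_not hz, mul_zero]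
    exact Submodule.zero_mem _

/-- Induction on `n`, for all `g`, `M` and `b` at once: integrating out `x_r` leaves a function of
the same shape, with a partial integral of a sheared `g`, a minor of the reduced matrix and a
shortened vector. -/
theorem hasIntegralPi_liftInt {g : (Fin n → κ) → ℂ} (hg : IsGLFubini μ n g)
    (M : Matrix (Fin n) (Fin n) F) (hM : M.det ≠ 0) (b : Fin n → F) :
    D.HasIntegralPi μ (fun x => D.liftInt g (M *ᵥ x - b))
      ((D.absVal (Units.mk0 M.det hM))⁻¹ *
        algebraMap ℂ (CField Γ) (∫ w, g w ∂(Measure.pi fun _ => μ))) := by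
  have : ProperSpace κ := ProperSpace.of_locallyCompactSpace κ
  induction n with
  | zero =>
    have h1 : Units.mk0 M.det hM = 1 := Units.ext (by simp)
    rw [h1, absVal_one, inv_one, one_mul]
    change D.liftInt g _ = _
    rw [D.liftInt_of_nonneg fun i => i.elim0, Measure.pi_of_empty, integral_dirac]
    congr 2
    exact Subsingleton.elim _ _
  | succ n ih =>
    intro r
    obtain ⟨j, hj, hpiv⟩ := D.exists_pivot M hM r
    set d : Fˣ := Units.mk0 (M j r) hj with hd
    set q : Fin (n + 1) → F := fun i => if i = j then 0 else M i r / M j r with hq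
    have hqj : q j = 0 := if_pos rfl
    have hq0 : ∀ i, 0 ≤ D.ν (q i) := by
      intro i
      simp only [hq]
      split_ifs
      · simp
      · exact hpiv i
    have hr : D.residue (q j) = 0 := by rw [hqj, residue_zero]
    -- Row reduction by the pivot: after it, `x_r` occurs in row `j` only, as `d x_r - e(y)`.
    set M' : Matrix (Fin (n + 1)) (Fin (n + 1)) F := Matrix.of fun i l => M i l - q i * M j l
      with hM'
    set b' : Fin (n + 1) → F := fun i => b i - q i * b j with hb'
    set A := M'.submatrix j.succAbove r.succAbove with hA
    have hcol : ∀ i, i ≠ j → M' i r = 0 := by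
      intro i hi
      simp only [hM', hq, Matrix.of_apply, if_neg hi]
      rw [div_mul_cancel₀ _ hj, sub_self]
    have hrow : ∀ l, M' j l = M j l := by
      intro l
      simp [hM', hqj]
    have hdet' : M'.det = M.det :=
      Matrix.det_eq_of_forall_row_eq_smul_add_const (fun i => -q i) j (by simp [hqj])
        fun i l => by
          simp only [hM', Matrix.of_apply]
          ring
    have hdet : M.det = (-1) ^ (j + r : ℕ) * M j r * A.det := by
      rw [← hdet', Matrix.det_succ_column M' r, Finset.sum_eq_single j, hrow]
      · intro i _ hi
        rw [hcol i hi, mul_zero, zero_mul]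
      · simp
    have hAdet : A.det ≠ 0 := by
      intro h0
      rw [hdet, h0, mul_zero] at hM
      exact hM rfl
    have habs : D.absVal (Units.mk0 M.det hM) = D.absVal d * D.absVal (Units.mk0 A.det hAdet) := by
      have : Units.mk0 M.det hM = (-1) ^ (j + r : ℕ) * (d * Units.mk0 A.det hAdet) :=
        Units.ext (by simp [hdet, hd, mul_assoc])
      rw [this, absVal_mul, absVal_neg_one_pow, one_mul, absVal_mul]
    set s := shear j (fun i => D.residue (q i)) hr with hs
    have hgs : IsGLFubini μ (n + 1) fun u => g (s u) := hg.comp s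
    set e : (Fin n → F) → F := fun y => b' j - ∑ i, M' j (r.succAbove i) * y i with he
    have hsub : ∀ (x : F) (y : Fin n → F),
        D.liftInt g (M *ᵥ (r.insertNth (α := fun _ => F) x y) - b) =
          D.liftInt (fun u => g (s u)) (j.insertNth (α := fun _ => F) ((d : F) * x - e y)
            (A *ᵥ y - j.removeNth b')) := by
      intro x y
      have h1 : M *ᵥ (r.insertNth (α := fun _ => F) x y) - b = shear j q hqj
          (j.insertNth (α := fun _ => F) ((d : F) * x - e y) (A *ᵥ y - j.removeNth b')) := by
        have h2 : j.insertNth (α := fun _ => F) ((d : F) * x - e y) (A *ᵥ y - j.removeNth b') =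
            M' *ᵥ (r.insertNth (α := fun _ => F) x y) - b' := by
          funext i
          cases i using j.succAboveCases with
          | x =>
            simp only [Fin.insertNth_apply_same, Pi.sub_apply, Matrix.mulVec, dotProduct, he,
              Fin.sum_univ_succAbove _ r, Fin.insertNth_apply_succAbove]
            rw [hrow r, hd, Units.val_mk0]
            ring
          | p i =>
            simp only [Fin.insertNth_apply_same, Pi.sub_apply, Matrix.mulVec, dotProduct, he,
              Fin.sum_univ_succAbove _ r, Fin.insertNth_apply_succAbove, hA,
              Matrix.submatrix_apply, Fin.removeNth]
            rw [hcol _ (Fin.succAbove_ne j i), zero_mul, zero_add]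
        rw [h2]
        funext i
        have h3 : ∀ i, (M' *ᵥ (r.insertNth (α := fun _ => F) x y) - b') i =
            (M *ᵥ (r.insertNth (α := fun _ => F) x y) - b) i -
              q i * (M *ᵥ (r.insertNth (α := fun _ => F) x y) - b) j := by
          intro i
          simp only [Pi.sub_apply, Matrix.mulVec, dotProduct, hM', Matrix.of_apply, sub_mul,
            Finset.sum_sub_distrib, hb', mul_sub, Finset.mul_sum, mul_assoc]
          ring
        rw [shear_apply, Pi.add_apply, Pi.smul_apply, smul_eq_mul, h3, h3, hqj]
        ring
      rw [h1, D.liftInt_shear g j q hqj hq0 hr]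
    have hmem := fun y => D.liftInt_section_mem_integralGraph μ hgs j d (e y)
      (A *ᵥ y - j.removeNth b')
    refine ⟨fun y => ?_, ?_⟩
    · simp only [hsub]
      exact (D.mem_integrableFun_iff μ).2 ⟨_, hmem y⟩
    · simp only [hsub]
      -- The reduced shear leaves the Haar integral of `g` unchanged, so the final value involves
      -- neither `r` nor the pivot.
      have hval := hg.integral_shear j (fun i => D.residue (q i)) hr
      rw [← (hgs.integral_integral_section j)] at hval
      have := HasIntegralPi.smul D μ (D.absVal d)⁻¹
        (ih (hgs.integral_section j) A hAdet (j.removeNth b'))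
      rw [hval, ← mul_assoc, ← mul_inv, ← habs] at this
      exact this.congr D μ fun y => D.integral_eq μ (hmem y)

end HasIntegral

end SplitValuation

namespace SplitValuation

variable {F Γ κ : Type*} [Field F] [AddCommGroup Γ] [LinearOrder Γ] [IsOrderedAddMonoid Γ]
  [NontriviallyNormedField κ] [LocallyCompactSpace κ] [MeasurableSpace κ] [BorelSpace κ]
  (D : SplitValuation F Γ κ) (μ : Measure κ) [μ.IsAddHaarMeasure]

/-! ### Linear change of variables and negligible sets -/

section ChangeOfVariables

variable {n : ℕ}

theorem hasIntegralPi_liftPi {g : (Fin n → κ) → ℂ} (hg : IsGLFubini μ n g) (a : Fin n → F)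
    (γ : Fin n → Γ) (τ : GL (Fin n) F) :
    D.HasIntegralPi μ (fun x => D.liftPi g a γ ((τ : Matrix (Fin n) (Fin n) F) *ᵥ x))
      ((D.absVal (Matrix.GeneralLinearGroup.det τ))⁻¹ *
        (X (∑ i, γ i) * algebraMap ℂ (CField Γ) (∫ w, g w ∂(Measure.pi fun _ => μ)))) := by
  -- The scalings by `t(-γ_i)` are absorbed into the matrix; their determinant has absolute value
  -- `X^{-∑ γ_i}`.
  set M : Matrix (Fin n) (Fin n) F := Matrix.diagonal (fun i => D.tt (-γ i)) * τ with hMdef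
  set p : Fˣ := ∏ i, D.t (Multiplicative.ofAdd (-γ i)) with hp
  have hdet : M.det = ((p * Matrix.GeneralLinearGroup.det τ : Fˣ) : F) := by
    rw [hMdef, Matrix.det_mul, Matrix.det_diagonal, Units.val_mul, hp, Units.coe_prod]
    rfl
  have hM : M.det ≠ 0 := hdet ▸ Units.ne_zero _
  have hunit : Units.mk0 M.det hM = p * Matrix.GeneralLinearGroup.det τ := Units.ext hdet
  have habs : D.absVal p = (X (∑ i, γ i))⁻¹ := by
    rw [hp, absVal_prod, X_sum, ← Finset.prod_inv_distrib]
    exact Finset.prod_congr rfl fun i _ => by rw [absVal_t, X_neg]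
  have := D.hasIntegralPi_liftInt μ hg M hM fun i => a i * D.tt (-γ i)
  rw [hunit, absVal_mul, habs, mul_inv, inv_inv, mul_comm (X _), mul_assoc] at this
  refine this.congr D μ fun x => ?_
  rw [liftPi_eq_liftInt]
  congr 1
  funext i
  rw [hMdef, ← Matrix.mulVec_mulVec, Pi.sub_apply, Matrix.mulVec_diagonal]
  ring

/-- Fubini's theorem and the linear change of variables formula. -/
theorem exists_hasIntegralPi {f : (Fin n → F) → CField Γ} (hf : f ∈ D.integrablePi μ n) :
    ∃ c, ∀ σ : GL (Fin n) F,
      (fun x => f ((σ : Matrix (Fin n) (Fin n) F) *ᵥ x)) ∈ D.integrablePi μ n ∧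
      D.HasIntegralPi μ (fun x => f ((σ : Matrix (Fin n) (Fin n) F) *ᵥ x))
        ((D.absVal (Matrix.GeneralLinearGroup.det σ))⁻¹ * c) := by
  -- The constant `c` is fixed before `σ`, so linearity is used for all substitutions at once; `σ =
  -- 1` later identifies `c` as the integral of `f`.
  induction hf using Submodule.span_induction with
  | mem f h =>
    obtain ⟨g, a, γ, τ, hg, rfl⟩ := h
    refine ⟨(D.absVal (Matrix.GeneralLinearGroup.det τ))⁻¹ * (X (∑ i, γ i) *
      algebraMap ℂ (CField Γ) (∫ w, g w ∂(Measure.pi fun _ => μ))), fun σ => ?_⟩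
    have e : (fun x => D.liftPi g a γ ((τ : Matrix (Fin n) (Fin n) F) *ᵥ
        ((σ : Matrix (Fin n) (Fin n) F) *ᵥ x))) =
        fun x => D.liftPi g a γ (((τ * σ : GL (Fin n) F) : Matrix (Fin n) (Fin n) F) *ᵥ x) := by
      funext x
      rw [Matrix.mulVec_mulVec, Units.val_mul]
    rw [e]
    refine ⟨Submodule.subset_span ⟨g, a, γ, τ * σ, hg, rfl⟩, ?_⟩
    have := D.hasIntegralPi_liftPi μ hg a γ (τ * σ)
    rwa [map_mul, absVal_mul, mul_comm (D.absVal _), mul_inv, mul_assoc] at this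
  | zero =>
    refine ⟨0, fun σ => ⟨Submodule.zero_mem _, ?_⟩⟩
    rw [mul_zero]
    exact HasIntegralPi.zero D μ
  | add f f' _ _ ih ih' =>
    obtain ⟨c, hc⟩ := ih
    obtain ⟨c', hc'⟩ := ih'
    refine ⟨c + c', fun σ => ⟨Submodule.add_mem _ (hc σ).1 (hc' σ).1, ?_⟩⟩
    rw [mul_add]
    exact (hc σ).2.add D μ (hc' σ).2
  | smul k f _ ih =>
    obtain ⟨c, hc⟩ := ih
    refine ⟨k * c, fun σ => ⟨Submodule.smul_mem _ k (hc σ).1, ?_⟩⟩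
    rw [mul_left_comm]
    exact (hc σ).2.smul D μ k

theorem hasIntegralPi_integralPi {f : (Fin n → F) → CField Γ} (hf : f ∈ D.integrablePi μ n) :
    D.HasIntegralPi μ f (D.integralPi μ f) := by
  obtain ⟨c, hc⟩ := D.exists_hasIntegralPi μ hf
  have := (hc 1).2
  simp only [Units.val_one, Matrix.one_mulVec, map_one, absVal_one, inv_one, one_mul] at this
  rwa [HasIntegralPi.integralPi_eq D μ this]

theorem comp_mem_integrablePi {f : (Fin n → F) → CField Γ} (hf : f ∈ D.integrablePi μ n)
    (e : (Fin n → F) ≃ₗ[F] (Fin n → F)) : (fun x => f (e x)) ∈ D.integrablePi μ n ∧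
      D.integralPi μ (fun x => f (e x)) =
        (D.absVal (LinearEquiv.det e))⁻¹ * D.integralPi μ f := by
  obtain ⟨c, hc⟩ := D.exists_hasIntegralPi μ hf
  set σ : GL (Fin n) F := Matrix.GeneralLinearGroup.toLin.symm
    (LinearMap.GeneralLinearGroup.ofLinearEquiv e) with hσ
  have hlin : (σ : Matrix (Fin n) (Fin n) F).mulVecLin = (e : (Fin n → F) →ₗ[F] (Fin n → F)) := by
    rw [← Matrix.GeneralLinearGroup.coe_toLin, hσ, MulEquiv.apply_symm_apply]
    rfl
  have he : ∀ x, (σ : Matrix (Fin n) (Fin n) F) *ᵥ x = e x := fun x => by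
    rw [← Matrix.mulVecLin_apply, hlin, LinearEquiv.coe_coe]
  have hdet : Matrix.GeneralLinearGroup.det σ = LinearEquiv.det e := by
    refine Units.ext ?_
    rw [LinearEquiv.coe_det, ← hlin, ← Matrix.toLin'_apply', LinearMap.det_toLin']
    rfl
  have h1 := (hc 1).2
  simp only [Units.val_one, Matrix.one_mulVec, map_one, absVal_one, inv_one, one_mul] at h1
  have h2 := hc σ
  simp only [he, hdet] at h2
  rw [HasIntegralPi.integralPi_eq D μ h1]
  exact ⟨h2.1, HasIntegralPi.integralPi_eq D μ h2.2⟩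

/-- A Fubini function supported on the zeros of a non-zero polynomial has integral zero. -/
theorem HasIntegralPi.eq_zero_of_support {f : (Fin n → F) → CField Γ} {c : CField Γ}
    (h : D.HasIntegralPi μ f c) {p : MvPolynomial (Fin n) F} (hp : p ≠ 0)
    (hf : ∀ x, MvPolynomial.eval x p ≠ 0 → f x = 0) : c = 0 := by
  induction n generalizing c with
  | zero =>
    refine (show f Fin.elim0 = c from h).symm.trans (hf _ ?_)
    rw [MvPolynomial.eq_C_of_isEmpty p, MvPolynomial.eval_C]
    intro h0
    rw [MvPolynomial.eq_C_of_isEmpty p, h0, map_zero] at hp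
    exact hp rfl
  | succ n ih =>
    set P := MvPolynomial.finSuccEquiv F n p with hP
    have hP0 : P ≠ 0 := by
      rw [hP, Ne, EmbeddingLike.map_eq_zero_iff]
      exact hp
    -- View `p` as a polynomial in the first variable. Where its leading coefficient is non-zero at
    -- `y`, the section has finite support and integral zero; the partial integral is thus supported
    -- on the zeros of that coefficient.
    refine ih (h 0).2 (Polynomial.leadingCoeff_ne_zero.2 hP0) fun y hy => ?_
    refine D.integral_of_finite_support μ ((h 0).1 y) ?_
    have hQ : P.map (MvPolynomial.eval y) ≠ 0 := by
      intro h0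
      refine hy ?_
      have := congrArg (fun q => Polynomial.coeff q P.natDegree) h0
      simpa [Polynomial.coeff_map] using this
    refine (Polynomial.finite_setOfPred_isRoot hQ).subset fun x hx => ?_
    by_contra hroot
    refine hx (hf _ ?_)
    rw [Fin.insertNth_zero', MvPolynomial.eval_eq_eval_mv_eval']
    exact hroot

end ChangeOfVariables

/-! ### Integration on `M_N(F)` and independence of the extension -/

section Matrices

variable {N : ℕ} (T : (Fin (N ^ 2) → F) ≃ₗ[F] Matrix (Fin N) (Fin N) F)

omit [LocallyCompactSpace κ] [BorelSpace κ] [μ.IsAddHaarMeasure] in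
theorem mem_integrableMat_iff {f : Matrix (Fin N) (Fin N) F → CField Γ} :
    f ∈ D.integrableMat μ T ↔ (fun x => f (T x)) ∈ D.integrablePi μ (N ^ 2) := Iff.rfl

/-- The determinant as a polynomial in the coordinates given by `T`. -/
def detPoly : MvPolynomial (Fin (N ^ 2)) F :=
  Matrix.det (Matrix.of fun i j => ∑ k, MvPolynomial.C (T (Pi.single k 1) i j) * MvPolynomial.X k)

theorem eval_detPoly (x : Fin (N ^ 2) → F) : MvPolynomial.eval x (detPoly T) = (T x).det := by
  rw [detPoly, RingHom.map_det]
  congr 1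
  ext i j
  have hx : T x = ∑ k, x k • T (Pi.single k 1) := by
    conv_lhs => rw [pi_eq_sum_univ' x]
    rw [map_sum]
    simp only [map_smul]
  rw [hx, Matrix.sum_apply]
  simp [mul_comm]

theorem detPoly_ne_zero : detPoly T ≠ 0 := by
  intro h
  have := eval_detPoly T (T.symm 1)
  simp [h] at this

/-- A function of `𝓛(M_N(F))` vanishing on `GL_N(F)` has integral zero. -/
theorem integralMat_eq_zero {f : Matrix (Fin N) (Fin N) F → CField Γ}
    (hf : f ∈ D.integrableMat μ T)
    (h0 : ∀ τ : GL (Fin N) F, f (τ : Matrix (Fin N) (Fin N) F) = 0) :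
    D.integralMat μ T f = 0 := by
  refine HasIntegralPi.eq_zero_of_support D μ
    (D.hasIntegralPi_integralPi μ ((D.mem_integrableMat_iff μ T).1 hf)) (detPoly_ne_zero T)
    fun x hx => ?_
  rw [eval_detPoly] at hx
  exact h0 (Matrix.GeneralLinearGroup.mkOfDetNeZero _ hx)

theorem integralMat_sub {f f' : Matrix (Fin N) (Fin N) F → CField Γ}
    (hf : f ∈ D.integrableMat μ T) (hf' : f' ∈ D.integrableMat μ T) :
    D.integralMat μ T (f - f') = D.integralMat μ T f - D.integralMat μ T f' := by
  have h := D.hasIntegralPi_integralPi μ ((D.mem_integrableMat_iff μ T).1 hf)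
  have h' := D.hasIntegralPi_integralPi μ ((D.mem_integrableMat_iff μ T).1 hf')
  have := HasIntegralPi.integralPi_eq D μ (h.add D μ (h'.smul D μ (-1)))
  rw [neg_one_mul, ← sub_eq_add_neg, neg_one_smul, ← sub_eq_add_neg] at this
  exact this

theorem integralMat_smul {f : Matrix (Fin N) (Fin N) F → CField Γ} (k : CField Γ)
    (hf : f ∈ D.integrableMat μ T) :
    D.integralMat μ T (k • f) = k * D.integralMat μ T f :=
  HasIntegralPi.integralPi_eq D μ
    ((D.hasIntegralPi_integralPi μ ((D.mem_integrableMat_iff μ T).1 hf)).smul D μ k)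

/-- The difference of two extensions vanishes on `GL_N(F)`, so its integral is zero. -/
theorem integralGL_eq {φ : GL (Fin N) F → CField Γ} {f : Matrix (Fin N) (Fin N) F → CField Γ}
    (hf : D.IsExtension μ T φ f) : D.integralGL μ T φ = D.integralMat μ T f := by
  have hex : ∃ f, D.IsExtension μ T φ f := ⟨f, hf⟩
  rw [integralGL, dif_pos hex]
  obtain ⟨h1, h2⟩ := hex.choose_spec
  rw [← sub_eq_zero, ← D.integralMat_sub μ T h1 hf.1]
  refine D.integralMat_eq_zero μ T (Submodule.sub_mem _ h1 hf.1) fun τ => ?_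
  rw [Pi.sub_apply, h2, hf.2, sub_self]

/-- Transport through `T` conjugates `e`, which leaves its determinant unchanged. -/
theorem comp_mem_integrableMat {f : Matrix (Fin N) (Fin N) F → CField Γ}
    (hf : f ∈ D.integrableMat μ T)
    (e : Matrix (Fin N) (Fin N) F ≃ₗ[F] Matrix (Fin N) (Fin N) F) :
    (fun x => f (e x)) ∈ D.integrableMat μ T ∧
      D.integralMat μ T (fun x => f (e x)) =
        (D.absVal (LinearEquiv.det e))⁻¹ * D.integralMat μ T f := by
  have h := D.comp_mem_integrablePi μ ((D.mem_integrableMat_iff μ T).1 hf)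
    (T.trans (e.trans T.symm))
  simp only [LinearEquiv.trans_apply, LinearEquiv.apply_symm_apply] at h
  have hdet : LinearEquiv.det (T.trans (e.trans T.symm)) = LinearEquiv.det e := by
    have := LinearEquiv.det_conj e T.symm
    rwa [LinearEquiv.symm_symm] at this
  rw [hdet] at h
  exact h

end Matrices

end SplitValuation

/-! ### Determinants of left and right multiplication -/

section MatrixDet

variable {F : Type*} [Field F] {N : ℕ}

theorem det_mulRight_eq_pow (A : Matrix (Fin N) (Fin N) F) :
    LinearMap.det (LinearMap.mulRight F A) = A.det ^ N := by
  -- Right multiplication by `A` acts on each of the `N` rows by `Aᵀ`, so its determinant is a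
  -- product of `N` equal factors.
  have h : LinearMap.mulRight F A = (Matrix.ofLinearEquiv F).toLinearMap ∘ₗ
      LinearMap.pi (fun i => (Matrix.toLin' Aᵀ).comp (LinearMap.proj (φ := fun _ : Fin N =>
        Fin N → F) i)) ∘ₗ (Matrix.ofLinearEquiv F).symm.toLinearMap := by
    refine LinearMap.ext fun B => ?_
    ext i l
    simp [Matrix.mul_apply, Matrix.mulVec, dotProduct, mul_comm]
  rw [h, LinearMap.det_conj, LinearMap.det_pi]
  simp

theorem det_mulLeft_eq_pow (A : Matrix (Fin N) (Fin N) F) :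
    LinearMap.det (LinearMap.mulLeft F A) = A.det ^ N := by
  have h : LinearMap.mulLeft F A =
      (Matrix.transposeLinearEquiv (Fin N) (Fin N) F F).toLinearMap ∘ₗ LinearMap.mulRight F Aᵀ ∘ₗ
        (Matrix.transposeLinearEquiv (Fin N) (Fin N) F F).symm.toLinearMap := by
    refine LinearMap.ext fun B => ?_
    simp
  rw [h, LinearMap.det_conj, det_mulRight_eq_pow, Matrix.det_transpose]

/-- Left multiplication by an invertible matrix. -/
def mulLeftEquiv (σ : GL (Fin N) F) : Matrix (Fin N) (Fin N) F ≃ₗ[F] Matrix (Fin N) (Fin N) F :=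
  LinearEquiv.ofLinearMap (LinearMap.mulLeft F (σ : Matrix (Fin N) (Fin N) F))
    (LinearMap.mulLeft F ((σ⁻¹ : GL (Fin N) F) : Matrix (Fin N) (Fin N) F))
    (by rw [← LinearMap.mulLeft_mul, Units.mul_inv, LinearMap.mulLeft_one])
    (by rw [← LinearMap.mulLeft_mul, Units.inv_mul, LinearMap.mulLeft_one])

/-- Right multiplication by an invertible matrix. -/
def mulRightEquiv (σ : GL (Fin N) F) : Matrix (Fin N) (Fin N) F ≃ₗ[F] Matrix (Fin N) (Fin N) F :=
  LinearEquiv.ofLinearMap (LinearMap.mulRight F (σ : Matrix (Fin N) (Fin N) F))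
    (LinearMap.mulRight F ((σ⁻¹ : GL (Fin N) F) : Matrix (Fin N) (Fin N) F))
    (by rw [← LinearMap.mulRight_mul, Units.inv_mul, LinearMap.mulRight_one])
    (by rw [← LinearMap.mulRight_mul, Units.mul_inv, LinearMap.mulRight_one])

theorem det_mulLeftEquiv (σ : GL (Fin N) F) :
    LinearEquiv.det (mulLeftEquiv σ) = Matrix.GeneralLinearGroup.det σ ^ N := by
  refine Units.ext ?_
  rw [LinearEquiv.coe_det, Units.val_pow_eq_pow_val]
  exact det_mulLeft_eq_pow (σ : Matrix (Fin N) (Fin N) F)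

theorem det_mulRightEquiv (σ : GL (Fin N) F) :
    LinearEquiv.det (mulRightEquiv σ) = Matrix.GeneralLinearGroup.det σ ^ N := by
  refine Units.ext ?_
  rw [LinearEquiv.coe_det, Units.val_pow_eq_pow_val]
  exact det_mulRight_eq_pow (σ : Matrix (Fin N) (Fin N) F)

end MatrixDet

/-! ### Translation invariance on `GL_N(F)` -/

namespace SplitValuation

variable {F Γ κ : Type*} [Field F] [AddCommGroup Γ] [LinearOrder Γ] [IsOrderedAddMonoid Γ]
  [NontriviallyNormedField κ] [LocallyCompactSpace κ] [MeasurableSpace κ] [BorelSpace κ]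
  (D : SplitValuation F Γ κ) (μ : Measure κ) [μ.IsAddHaarMeasure]
  {N : ℕ} (T : (Fin (N ^ 2) → F) ≃ₗ[F] Matrix (Fin N) (Fin N) F)

/-- Invariance of the integral on `GL_N(F)` under a bijection `m` of `GL_N(F)` that scales the
determinant by that of `σ` and is induced by a linear map of determinant `det σ ^ N`. -/
theorem integralGL_comp {φ : GL (Fin N) F → CField Γ} (hφ : φ ∈ D.integrableGL μ T)
    (σ : GL (Fin N) F) (e : Matrix (Fin N) (Fin N) F ≃ₗ[F] Matrix (Fin N) (Fin N) F)
    (he : LinearEquiv.det e = Matrix.GeneralLinearGroup.det σ ^ N)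
    (m : GL (Fin N) F → GL (Fin N) F)
    (hm : ∀ τ : GL (Fin N) F, e (τ : Matrix (Fin N) (Fin N) F) = (m τ : Matrix (Fin N) (Fin N) F))
    (hdet : ∀ τ, Matrix.GeneralLinearGroup.det (m τ) =
      Matrix.GeneralLinearGroup.det σ * Matrix.GeneralLinearGroup.det τ) :
    (fun τ => φ (m τ)) ∈ D.integrableGL μ T ∧
      D.integralGL μ T (fun τ => φ (m τ)) = D.integralGL μ T φ := by
  obtain ⟨f, hf⟩ := hφ
  obtain ⟨h1, h2⟩ := D.comp_mem_integrableMat μ T hf.1 e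
  set k : CField Γ := D.absVal (Matrix.GeneralLinearGroup.det σ) ^ N with hk
  have hk0 : k ≠ 0 := pow_ne_zero _ (D.absVal_ne_zero _)
  -- The factor `k = |det σ|^N` corrects `|det (m τ)|^{-N}` to `|det τ|^{-N}`, and it cancels the
  -- Jacobian of `e` below.
  have hext : D.IsExtension μ T (fun τ => φ (m τ)) (k • fun x => f (e x)) := by
    refine ⟨Submodule.smul_mem _ k h1, fun τ => ?_⟩
    rw [Pi.smul_apply, smul_eq_mul, hm, hf.2, hdet, absVal_mul, mul_pow, mul_inv, ← hk]
    field_simp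
  refine ⟨⟨_, hext⟩, ?_⟩
  rw [D.integralGL_eq μ T hext, D.integralGL_eq μ T hf, D.integralMat_smul μ T k h1, h2, he,
    absVal_pow, ← hk, mul_inv_cancel_left₀ hk0]

end SplitValuation

end ValuedIntegration

end

theorem mainTheorem3 {F Γ κ : Type*} [Field F] [AddCommGroup Γ] [LinearOrder Γ]
    [IsOrderedAddMonoid Γ] [NontriviallyNormedField κ] [LocallyCompactSpace κ]
    [MeasurableSpace κ] [BorelSpace κ]
    (D : ValuedIntegration.SplitValuation F Γ κ)
    (μ : Measure κ) [μ.IsAddHaarMeasure]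
    (N : ℕ) (T : (Fin (N ^ 2) → F) ≃ₗ[F] Matrix (Fin N) (Fin N) F)
    (φ : GL (Fin N) F → ValuedIntegration.CField Γ) (hφ : φ ∈ D.integrableGL μ T)
    (σ : GL (Fin N) F) :
    (∀ f, D.IsExtension μ T φ f →
      D.IsFubini μ (f ∘ T) ∧ D.integralMat μ T f = D.integralGL μ T φ) ∧
    (fun τ => φ (σ * τ)) ∈ D.integrableGL μ T ∧
    (fun τ => φ (τ * σ)) ∈ D.integrableGL μ T ∧
    D.integralGL μ T (fun τ => φ (σ * τ)) = D.integralGL μ T φ ∧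
    D.integralGL μ T (fun τ => φ (τ * σ)) = D.integralGL μ T φ := by
  obtain ⟨hl, hl'⟩ := D.integralGL_comp μ T hφ σ (ValuedIntegration.mulLeftEquiv σ)
    (ValuedIntegration.det_mulLeftEquiv σ) (fun τ => σ * τ) (fun _ => rfl)
    (fun τ => map_mul _ σ τ)
  obtain ⟨hr, hr'⟩ := D.integralGL_comp μ T hφ σ (ValuedIntegration.mulRightEquiv σ)
    (ValuedIntegration.det_mulRightEquiv σ) (fun τ => τ * σ) (fun _ => rfl)
    (fun τ => (map_mul _ τ σ).trans (mul_comm _ _))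
  exact ⟨fun f hf => ⟨⟨_, D.hasIntegralPi_integralPi μ hf.1⟩, (D.integralGL_eq μ T hf).symm⟩,
    hl, hr, hl', hr'⟩
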